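/- **Definitions.** Let $\ell\ge 1$ be an integer and let $(A,B)=(0,-1)$ or $(A,B)=(-\tfrac12,-\tfrac12)$. Put $n=2(\ell+A+1)$ and $$b_o:=\frac{2}{n-2B}\Bigl(\frac{\ell(n-2B-\ell-1)}{2}+1\Bigr).$$ Let $\varphi_i(q)=\prod_{j=1}^{i}(q^j-1)$. For $I=\{i_1<\dots<i_r\}\subset[1,\ell-1]$ put, with $i_0=0$ and $i_{r+1}=\ell$, $\varphi_{(I)}(q)=\varphi_\ell(q)/\prod_{\nu=1}^{r+1}\varphi_{i_\nu-i_{\nu-1}}(q)$, and for $K\subset[1,\ell-1]$ put $w_{\ell,K}(q)=\sum_{I\subset K}(-1)^{\#(K-I)}\varphi_{(I)}(q)$. For a finite set $K\subset[0,\ell-1]$ put $a(K)=\sum_{i\in K}\bigl(\tfrac{\ell(\ell+1)}2-\tfrac{i(i+1)}2\bigr)$ and $b(K)=\sum_{i\in K}(\ell-1-i)$; for $J=\{j_1<\dots<j_t\}\subset[0,\ell-1]$ put $\langle J\rangle=\sum_{\nu=1}^t(-1)^\nu(j_\nu-\ell)$ and $$\mathscr U_{\ell,J}(X,u,T)=u^{b(J)}X^{a(J)}\sum_{\substack{I_0\subset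 J\cap[1,\ell-1]\\ I_1\subset[1,\ell-1]-J}}w_{\ell,I_0\cup I_1}(X^{-1})\bigl(X^{a(I_1)}u^{b(I_1)}T^{\#I_1}\bigr)^2 .$$ For $C\in\{B,-B\}$ let $U^{\rm even}_{\ell,C}(X,u,T)$ (resp. $U^{\rm odd}_{\ell,C}(X,u,T)$) be the sum of $X^{C\langle J\rangle}\,\mathscr U_{\ell,J}(X,u,T)\,T^{\#J}$ over all $J\subset[0,\ell-1]$ with $\#J$ even (resp. odd). Set $$W^{(0)}_{\ell,A,B}(X,T)=U^{\rm even}_{\ell,B}(X,X^A,X^AT)+U^{\rm odd}_{\ell,B}(X,X^A,X^AT)\,T,$$ $$W^{(1)}_{\ell,A,B}(X,T)=U^{\rm even}_{\ell,-B}(X,X^A,X^AT)\,T+U^{\rm odd}_{\ell,-B}(X,X^A,X^AT),$$ $$W^{\rm total}_{\ell,A,B}(X,Y)=W^{(0)}_{\ell,A,B}(X,Y^n)+W^{(1)}_{\ell,A,B}(X,Y^n)\,Y^{-2B},$$ and consider the Euler product over all primes $$\mathfrak E(s)=\prod_p W^{\rm total}_{\ell,A,B}(p,p^{-s/2}).$$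 **Proposition.** For every integer $\ell\ge1$ and for $(A,B)=(0,-1)$ or $(-\tfrac12,-\tfrac12)$: 1. The Euler product $\mathfrak E(s)$ converges absolutely and locally uniformly on $\mathrm{Re}(s)>b_o$; that is, $\sum_p|W^{\rm total}_{\ell,A,B}(p,p^{-s/2})-1|$ and the product itself converge there, both locally uniformly. 2. $\mathfrak E(s)$ has a meromorphic continuation to a half-plane $\mathrm{Re}(s)>c$ with $c<b_o$, and the continuation has a simple pole at $s=b_o$. 3. $b_o$ is the abscissa of convergence of $\mathfrak E$: it is the infimum of the real $x$ such that the Euler product converges at every $s$ with $\mathrm{Re}(s)>x$; moreover on $\mathrm{Re}(s)>b_o$ the product equals a Dirichlet series $\sum_{m\ge1}a_m m^{-s}$ with $a_m\ge0$, whose abscissa of convergence and abscissa of absolute convergence are both equal to $b_o$. -/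

import Mathlib

namespace TotalASH

noncomputable section

/-- `φ_i(q) = ∏_{j=1}^{i} (q^j - 1)`. -/
def phi (i : ℕ) (q : ℂ) : ℂ := ∏ j ∈ Finset.Icc 1 i, (q ^ j - 1)

/-- The element of `{0} ∪ I` immediately preceding `i`: the largest element of `I` smaller than
`i`, and `0` if there is none. -/
def pred (I : Finset ℕ) (i : ℕ) : ℕ := (I.filter (· < i)).sup id

/-- For `I = {i_1 < ⋯ < i_r} ⊆ [1, ℓ-1]`, with `i_0 = 0` and `i_{r+1} = ℓ`,
`φ_{(I)}(q) = φ_ℓ(q) / ∏_{ν=1}^{r+1} φ_{i_ν - i_{ν-1}}(q)`. -/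
def phiSet (ℓ : ℕ) (I : Finset ℕ) (q : ℂ) : ℂ :=
  phi ℓ q / ∏ i ∈ insert ℓ I, phi (i - pred I i) q

/-- `w_{ℓ,K}(q) = ∑_{I ⊆ K} (-1)^{#(K - I)} φ_{(I)}(q)`. -/
def w (ℓ : ℕ) (K : Finset ℕ) (q : ℂ) : ℂ :=
  ∑ I ∈ K.powerset, (-1) ^ (K \ I).card * phiSet ℓ I q

/-- `a_ℓ^{(-1)}(K) = ∑_{i ∈ K} (-i(i+1)/2 + ℓ(ℓ+1)/2)`; both divisions are exact. -/
def aExp (ℓ : ℕ) (K : Finset ℕ) : ℤ :=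
  ∑ i ∈ K, (-((i : ℤ) * (i + 1) / 2) + (ℓ : ℤ) * (ℓ + 1) / 2)

/-- `b_ℓ(K) = ∑_{i ∈ K} (ℓ - 1 - i)`. -/
def bExp (ℓ : ℕ) (K : Finset ℕ) : ℤ := ∑ i ∈ K, ((ℓ : ℤ) - 1 - i)

/-- `⟨J⟩ = ∑_{ν=1}^{t} (-1)^ν (j_ν - ℓ)` for `J = {j_1 < ⋯ < j_t}`; the position `ν` of `j` is the
number of elements of `J` that are at most `j`. -/
def bracket (ℓ : ℕ) (J : Finset ℕ) : ℤ :=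
  ∑ j ∈ J, (-1) ^ (J.filter (· ≤ j)).card * ((j : ℤ) - ℓ)

/-- `𝒰_{ℓ,J}(X,u,T)`, for `J ⊆ [0, ℓ-1]`. -/
def scriptU (ℓ : ℕ) (J : Finset ℕ) (X u T : ℂ) : ℂ :=
  u ^ bExp ℓ J * X ^ aExp ℓ J *
    ∑ I₀ ∈ (J ∩ Finset.Icc 1 (ℓ - 1)).powerset,
      ∑ I₁ ∈ (Finset.Icc 1 (ℓ - 1) \ J).powerset,
        w ℓ (I₀ ∪ I₁) X⁻¹ * (X ^ aExp ℓ I₁ * u ^ bExp ℓ I₁ * T ^ I₁.card) ^ 2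

/-- `U^•_{ℓ,B}(X,u,T)`: the sum over the `J ⊆ [0, ℓ-1]` with `#J ≡ ε (mod 2)`, where `ε = 0` for
`• = even` and `ε = 1` for `• = odd`. -/
def U (ε : ℕ) (ℓ : ℕ) (B : ℝ) (X u T : ℂ) : ℂ :=
  ∑ J ∈ (Finset.range ℓ).powerset.filter (fun J => J.card ≡ ε [MOD 2]),
    X ^ ((B * bracket ℓ J : ℝ) : ℂ) * scriptU ℓ J X u T * T ^ J.card

/-- `W^{(0)}_{ℓ,A,B}(X,T)`. -/
def W0 (ℓ : ℕ) (A B : ℝ) (X T : ℂ) : ℂ :=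
  U 0 ℓ B X (X ^ (A : ℂ)) (X ^ (A : ℂ) * T) + U 1 ℓ B X (X ^ (A : ℂ)) (X ^ (A : ℂ) * T) * T

/-- `W^{(1)}_{ℓ,A,B}(X,T)`. -/
def W1 (ℓ : ℕ) (A B : ℝ) (X T : ℂ) : ℂ :=
  U 0 ℓ (-B) X (X ^ (A : ℂ)) (X ^ (A : ℂ) * T) * T + U 1 ℓ (-B) X (X ^ (A : ℂ)) (X ^ (A : ℂ) * T)

/-- `n = 2(ℓ + A + 1)`. -/
def dim (ℓ : ℕ) (A : ℝ) : ℝ := 2 * (ℓ + A + 1)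

/-- The value at `(X, Y)` of the total ASH polynomial
`W^{total}_{ℓ,A,B}(X,Y) = W^{(0)}_{ℓ,A,B}(X,Y^n) + W^{(1)}_{ℓ,A,B}(X,Y^n) Y^{-2B}`.
In the cases considered, `n` and `-2B` are positive integers, so that the complex powers of `Y` are
ordinary powers. -/
def Wtotal (ℓ : ℕ) (A B : ℝ) (X Y : ℂ) : ℂ :=
  W0 ℓ A B X (Y ^ (dim ℓ A : ℂ)) + W1 ℓ A B X (Y ^ (dim ℓ A : ℂ)) * Y ^ ((-2 * B : ℝ) : ℂ)

/-- The factor `W^{total}_{ℓ,A,B}(p, p^{-s/2})` of the Euler product. -/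
def eulerFactor (ℓ : ℕ) (A B : ℝ) (p : ℕ) (s : ℂ) : ℂ :=
  Wtotal ℓ A B (p : ℂ) ((p : ℂ) ^ (-s / 2))

/-- `b_o = 2/(n-2B) * (ℓ(n-2B-ℓ-1)/2 + 1)`. -/
def bo (ℓ : ℕ) (A B : ℝ) : ℝ :=
  2 / (dim ℓ A - 2 * B) * (ℓ * (dim ℓ A - 2 * B - ℓ - 1) / 2 + 1)

/-- Convergence of an infinite product `∏_p f p` over the primes in increasing order: after
omitting finitely many factors, the partial products have a nonzero limit. -/
def PrimeProdConverges (f : ℕ → ℂ) : Prop :=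
  ∃ M : ℕ, ∃ L : ℂ, L ≠ 0 ∧
    Filter.Tendsto (fun N : ℕ => ∏ p ∈ (Finset.Ico M N).filter Nat.Prime, f p)
      Filter.atTop (nhds L)

/-- The abscissa of convergence of an Euler product `∏_p f p s`: the infimum of the real numbers
`x` such that the product converges at every point of the half-plane `Re s > x`. -/
def eulerAbscissa (f : ℕ → ℂ → ℂ) : EReal :=
  sInf (Real.toEReal '' {x : ℝ | ∀ s : ℂ, x < s.re → PrimeProdConverges fun p => f p s})

/-- The abscissa of (conditional) convergence of the Dirichlet series `∑_{m ≥ 1} a m * m^{-s}`. -/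
def dirichletAbscissa (a : ℕ → ℂ) : EReal :=
  sInf (Real.toEReal '' {x : ℝ | ∃ L : ℂ,
    Filter.Tendsto (fun N : ℕ => ∑ m ∈ Finset.range N, LSeries.term a (x : ℂ) m)
      Filter.atTop (nhds L)})

end

end TotalASH

namespace TotalASH

open Filter Topology Finset

/-! Expanded, the Euler factor is a finite sum of monomials `w(1/p) p^(α - ks)` indexed by `(ω, J,
I₀, I₁)`. The index `(0, ∅, ∅, ∅)` gives `1`, and `(1, {0}, ∅, ∅)` gives `p^(e - ds)` with `d = (n -
2B)/2` and `e = ℓ(n - 2B - ℓ - 1)/2`, so that `b_o = (e + 1)/d`. Everything rests on two facts about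
the other monomials.

Their exponents satisfy `(α + 1)/k < b_o` (`xExp_add_one_lt`), so their sum over the primes
converges absolutely somewhat to the left of `b_o`. Their coefficients `w(1/p)` are bounded
(`realW_le`) and nonnegative (`realW_nonneg`); the latter holds because, up to a positive factor,
`w` is a generating function of integer sequences with prescribed strict ascents.

The rest is a general statement about such products, `EulerData`. Multiplying each factor by `1 -
p^(e - ds)` cancels the dominant term to first order, so the product equals `ζ(ds - e) G(s)` with
`G` holomorphic on a half-plane containing `b_o`. Since `G(b_o) ≠ 0`, the pole of `ζ` at `1` yields
a simple pole at `b_o`. At `s = b_o` each factor is at least `1 + 1/p`, so the Euler product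
diverges there; the Dirichlet series has nonnegative coefficients and contains the terms at `p^d`,
each at least `1/p`, so it diverges as well. -/

/-! ### Abscissas and infinite products over the primes -/

lemma sInf_image_toEReal_eq {S : Set ℝ} {b : ℝ} (h₁ : Set.Ioi b ⊆ S) (h₂ : S ⊆ Set.Ici b) :
    sInf (Real.toEReal '' S) = (b : EReal) := by
  apply le_antisymm
  · refine le_of_forall_gt (α := EReal) fun y hy => ?_
    obtain ⟨x, hx₁, hx₂⟩ := EReal.lt_iff_exists_real_btwn.1 hy
    exact (sInf_le (Set.mem_image_of_mem _ (h₁ (EReal.coe_lt_coe_iff.1 hx₁)))).trans_lt hx₂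
  · refine le_sInf ?_
    rintro _ ⟨x, hx, rfl⟩
    exact EReal.coe_le_coe_iff.2 (h₂ hx)

/-- If `∑_p |f p - 1|` converges then so does `∏_p f p`, in the sense that a tail of it has a
nonzero limit. -/
lemma primeProdConverges_of_summable {f : ℕ → ℂ}
    (hf : Summable fun p : Nat.Primes => ‖f p - 1‖) : PrimeProdConverges f := by
  have hs : Summable fun n : ℕ => if n.Prime then ‖f n - 1‖ else 0 :=
    (Nat.Primes.summable_iff_summable_ite fun n => ‖f n - 1‖).1 hf
  -- Beyond `M` every factor at a prime lies within distance less than `1` of `1`, hence does not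
  -- vanish.
  obtain ⟨M, hM⟩ := eventually_atTop.1 (hs.tendsto_atTop_zero.eventually_lt_const one_pos)
  set H : ℕ → ℂ := fun n => if n.Prime ∧ M ≤ n then f n - 1 else 0 with hH
  have hHs : Summable fun n => ‖H n‖ := by
    refine hs.of_nonneg_of_le (fun _ => norm_nonneg _) fun n => ?_
    by_cases h1 : n.Prime <;> by_cases h2 : M ≤ n <;> simp [hH, h1, h2]
  have hne : ∀ n, 1 + H n ≠ 0 := by
    intro n h0
    by_cases h : n.Prime ∧ M ≤ n
    · have h1 := hM n h.2
      simp only [h.1, if_true] at h1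
      have h2 : f n - 1 = -1 := by
        have : 1 + (f n - 1) = 0 := by simpa [hH, h] using h0
        linear_combination this
      rw [h2] at h1
      simp at h1
    · simp [hH, h] at h0
  refine ⟨M, ∏' n, (1 + H n), tprod_one_add_ne_zero_of_summable hne hHs, ?_⟩
  refine ((multipliable_one_add_of_summable hHs).hasProd.tendsto_prod_nat).congr fun N => ?_
  have h1 : (Finset.Ico M N).filter Nat.Prime
      = (Finset.range N).filter (fun n => n.Prime ∧ M ≤ n) := by
    ext n; simp only [mem_filter, mem_Ico, mem_range]; tauto
  rw [h1, Finset.prod_filter]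
  refine Finset.prod_congr rfl fun n _ => ?_
  by_cases h : n.Prime ∧ M ≤ n <;> simp [hH, h]

lemma sum_le_prod_one_add {ι : Type*} (s : Finset ι) {f : ι → ℝ} (hf : ∀ i, 0 ≤ f i) :
    ∑ i ∈ s, f i ≤ ∏ i ∈ s, (1 + f i) := by
  classical
  suffices h : 1 + ∑ i ∈ s, f i ≤ ∏ i ∈ s, (1 + f i) by linarith
  induction s using Finset.induction_on with
  | empty => simp
  | insert i s hi ih =>
    rw [Finset.sum_insert hi, Finset.prod_insert hi]
    have h1 : 0 ≤ ∑ j ∈ s, f j := Finset.sum_nonneg fun j _ => hf j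
    nlinarith [mul_nonneg (hf i) h1, mul_le_mul_of_nonneg_left ih (hf i)]

/-- An infinite product over the primes whose factors are at least `1 + 1/p` diverges. -/
lemma not_primeProdConverges {f : ℕ → ℂ} {F : ℕ → ℝ} (hf : ∀ p, p.Prime → f p = F p)
    (hF : ∀ p : ℕ, p.Prime → 1 + 1 / (p : ℝ) ≤ F p) : ¬ PrimeProdConverges f := by
  rintro ⟨M, L, -, hL⟩
  apply not_summable_one_div_on_primes
  -- The convergent partial products are bounded, and they majorize the partial sums of `∑ 1/p`.
  have hbdd := hL.norm.bddAbove_range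
  obtain ⟨C, hC⟩ := hbdd
  have hC' : ∀ N, ∑ p ∈ (Finset.Ico M N).filter Nat.Prime, (1 / (p : ℝ)) ≤ C := by
    intro N
    have h1 : ‖∏ p ∈ (Finset.Ico M N).filter Nat.Prime, f p‖ ≤ C := hC ⟨N, rfl⟩
    rw [norm_prod] at h1
    have h2 : ∑ p ∈ (Finset.Ico M N).filter Nat.Prime, (1 / (p : ℝ))
        ≤ ∏ p ∈ (Finset.Ico M N).filter Nat.Prime, (1 + 1 / (p : ℝ)) :=
      sum_le_prod_one_add _ fun p => by positivity
    refine (h2.trans ?_).trans h1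
    refine Finset.prod_le_prod (fun p _ => by positivity) fun p hp => ?_
    have hp' := (mem_filter.1 hp).2
    rw [hf p hp', Complex.norm_real]
    exact (hF p hp').trans (le_abs_self _)
  rw [← summable_nat_add_iff M]
  refine summable_of_sum_range_le (c := C) (fun n => Set.indicator_nonneg (fun _ _ => by positivity) _)
    fun N => ?_
  refine le_trans (le_of_eq ?_) (hC' (M + N))
  rw [Finset.sum_filter, Finset.sum_Ico_eq_sum_range]
  refine Finset.sum_congr (by simp) fun n _ => ?_
  simp [Set.indicator_apply, add_comm]

/-! ### Euler products with one dominant term: convergence -/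

/-- The data of an Euler product `∏_p (1 + p^{e - ds} + ∑_i c_i(p) p^{α_i - k_i s})` with
nonnegative bounded `c_i` in which the term `p^{e - ds}` dominates. -/
structure EulerData where
  ι : Type
  S : Finset ι
  c : ι → ℕ → ℝ
  M : ℝ
  α : ι → ℝ
  k : ι → ℕ
  e : ℝ
  d : ℕ
  b : ℝ
  c_nonneg : ∀ i ∈ S, ∀ p : ℕ, p.Prime → 0 ≤ c i p
  c_le : ∀ i ∈ S, ∀ p : ℕ, p.Prime → c i p ≤ M
  d_pos : 0 < d
  k_pos : ∀ i ∈ S, 0 < k i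
  -- At `s = b` the dominant term is exactly `1/p`, whereas each other term is summable over the
  -- primes.
  d_mul_b : d * b = e + 1
  dominated : ∀ i ∈ S, α i + 1 < k i * b

namespace EulerData

variable (D : EulerData)

/-- The dominant term of the Euler factor. -/
noncomputable def main (p : ℕ) (s : ℂ) : ℂ := (p : ℂ) ^ ((D.e : ℂ) - D.d * s)

/-- The sum of the dominated terms of the Euler factor. -/
noncomputable def tail (p : ℕ) (s : ℂ) : ℂ :=
  ∑ i ∈ D.S, (D.c i p : ℂ) * (p : ℂ) ^ ((D.α i : ℂ) - D.k i * s)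

/-- The Euler factor. -/
noncomputable def factor (p : ℕ) (s : ℂ) : ℂ := 1 + D.main p s + D.tail p s

/-- The bound for `‖tail p s‖` on `Re s ≥ x`. -/
noncomputable def tailBound (x : ℝ) (p : ℕ) : ℝ :=
  ∑ i ∈ D.S, D.M * (p : ℝ) ^ (D.α i - D.k i * x)

lemma norm_main {p : ℕ} (hp : p.Prime) (s : ℂ) :
    ‖D.main p s‖ = (p : ℝ) ^ (D.e - D.d * s.re) := by
  rw [main, Complex.norm_natCast_cpow_of_pos hp.pos]
  simp

lemma norm_main_le {p : ℕ} (hp : p.Prime) {x : ℝ} {s : ℂ} (hs : x ≤ s.re) :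
    ‖D.main p s‖ ≤ (p : ℝ) ^ (D.e - D.d * x) := by
  rw [D.norm_main hp]
  exact Real.rpow_le_rpow_of_exponent_le (by exact_mod_cast hp.one_le) (by gcongr)

lemma norm_tail_le {p : ℕ} (hp : p.Prime) {x : ℝ} {s : ℂ} (hs : x ≤ s.re) :
    ‖D.tail p s‖ ≤ D.tailBound x p := by
  refine (norm_sum_le _ _).trans (Finset.sum_le_sum fun i hi => ?_)
  rw [norm_mul, Complex.norm_natCast_cpow_of_pos hp.pos, Complex.norm_real, Real.norm_eq_abs,
    abs_of_nonneg (D.c_nonneg i hi p hp)]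
  have h1 : ((D.α i : ℂ) - D.k i * s).re = D.α i - D.k i * s.re := by simp
  rw [h1]
  refine mul_le_mul (D.c_le i hi p hp) ?_ (by positivity)
    ((D.c_nonneg i hi p hp).trans (D.c_le i hi p hp))
  exact Real.rpow_le_rpow_of_exponent_le (by exact_mod_cast hp.one_le) (by gcongr)

lemma summable_tailBound {x : ℝ} (hx : ∀ i ∈ D.S, D.α i + 1 < D.k i * x) :
    Summable fun p : Nat.Primes => D.tailBound x p := by
  refine summable_sum fun i hi => Summable.mul_left _ (Nat.Primes.summable_rpow.2 ?_)
  linarith [hx i hi]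

lemma differentiable_main {p : ℕ} (hp : p.Prime) : Differentiable ℂ (D.main p) := by
  have : (p : ℂ) ≠ 0 := by exact_mod_cast hp.ne_zero
  unfold main
  intro s
  exact DifferentiableAt.const_cpow (by fun_prop) (Or.inl this)

lemma differentiable_tail {p : ℕ} (hp : p.Prime) : Differentiable ℂ (D.tail p) := by
  have : (p : ℂ) ≠ 0 := by exact_mod_cast hp.ne_zero
  unfold tail
  refine Differentiable.fun_sum fun i _ => ?_
  intro s
  exact (DifferentiableAt.const_cpow (by fun_prop) (Or.inl this)).const_mul _

/-- The bound for `‖factor p s - 1‖` on `Re s ≥ x`. -/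
lemma norm_factor_sub_one_le {p : ℕ} (hp : p.Prime) {x : ℝ} {s : ℂ} (hs : x ≤ s.re) :
    ‖D.factor p s - 1‖ ≤ (p : ℝ) ^ (D.e - D.d * x) + D.tailBound x p := by
  have : D.factor p s - 1 = D.main p s + D.tail p s := by rw [factor]; ring
  rw [this]
  exact (norm_add_le _ _).trans (add_le_add (D.norm_main_le hp hs) (D.norm_tail_le hp hs))

lemma summable_bound {x : ℝ} (hx : D.b < x) :
    Summable fun p : Nat.Primes => (p : ℝ) ^ (D.e - D.d * x) + D.tailBound x p := by
  refine (Nat.Primes.summable_rpow.2 ?_).add (D.summable_tailBound fun i hi => ?_)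
  · have : (D.d : ℝ) * D.b < D.d * x :=
      mul_lt_mul_of_pos_left hx (by exact_mod_cast D.d_pos)
    linarith [D.d_mul_b]
  · exact (D.dominated i hi).trans
      (mul_lt_mul_of_pos_left hx (by exact_mod_cast D.k_pos i hi))

lemma summable_norm_factor_sub_one {s : ℂ} (hs : D.b < s.re) :
    Summable fun p : Nat.Primes => ‖D.factor p s - 1‖ :=
  (D.summable_bound hs).of_nonneg_of_le (fun _ => norm_nonneg _)
    fun p => D.norm_factor_sub_one_le p.2 le_rfl

lemma isOpen_halfPlane (x : ℝ) : IsOpen {s : ℂ | x < s.re} :=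
  isOpen_lt continuous_const Complex.continuous_re

lemma exists_lt_forall_le_re {x : ℝ} {K : Set ℂ} (hK : K ⊆ {s : ℂ | x < s.re})
    (hc : IsCompact K) : ∃ y, x < y ∧ ∀ s ∈ K, y ≤ s.re := by
  rcases K.eq_empty_or_nonempty with rfl | hne
  · exact ⟨x + 1, by linarith, by simp⟩
  · obtain ⟨s, hs, hmin⟩ := hc.exists_isMinOn hne Complex.continuous_re.continuousOn
    exact ⟨s.re, hK hs, fun t ht => hmin ht⟩

lemma summableLocallyUniformlyOn :
    SummableLocallyUniformlyOn (fun (p : Nat.Primes) (s : ℂ) => ‖D.factor p s - 1‖)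
      {s : ℂ | D.b < s.re} := by
  refine SummableLocallyUniformlyOn_of_locally_bounded (isOpen_halfPlane _) fun K hK hc => ?_
  obtain ⟨y, hy, hKy⟩ := exists_lt_forall_le_re hK hc
  exact ⟨_, D.summable_bound hy, fun p s hs => by
    simpa using D.norm_factor_sub_one_le p.2 (hKy s hs)⟩

lemma differentiable_factor {p : ℕ} (hp : p.Prime) : Differentiable ℂ (D.factor p) :=
  ((differentiable_const _).add (D.differentiable_main hp)).add (D.differentiable_tail hp)

lemma multipliableLocallyUniformlyOn :
    MultipliableLocallyUniformlyOn (fun (p : Nat.Primes) (s : ℂ) => D.factor p s)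
      {s : ℂ | D.b < s.re} := by
  have h : HasProdLocallyUniformlyOn (fun (p : Nat.Primes) (s : ℂ) => 1 + (D.factor p s - 1))
      (fun s => ∏' p : Nat.Primes, (1 + (D.factor p s - 1))) {s : ℂ | D.b < s.re} := by
    refine hasProdLocallyUniformlyOn_of_forall_compact (isOpen_halfPlane _) fun K hK hc => ?_
    obtain ⟨y, hy, hKy⟩ := exists_lt_forall_le_re hK hc
    exact Summable.hasProdUniformlyOn_one_add hc (D.summable_bound hy)
      (Eventually.of_forall fun p s hs => D.norm_factor_sub_one_le p.2 (hKy s hs))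
      fun p => ((D.differentiable_factor p.2).continuous.sub continuous_const).continuousOn
  simpa only [add_sub_cancel] using h.multipliableLocallyUniformlyOn

/-! ### Meromorphic continuation -/

/-- All the inequalities are strict at `x = b` and finite in number, so they persist slightly to the
left. The `1/2` is what makes the squares `p^(2(e - dx))` summable. -/
lemma exists_continuation_abscissa :
    ∃ x < D.b, D.e + 1 / 2 < D.d * x ∧ ∀ i ∈ D.S, D.α i + 1 < D.k i * x := by
  have h1 : ∀ᶠ x in 𝓝 D.b, D.e + 1 / 2 < D.d * x :=
    (continuous_const.mul continuous_id).tendsto D.b |>.eventually_const_lt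
      (by change D.e + 1 / 2 < D.d * D.b; linarith [D.d_mul_b])
  have h2 : ∀ᶠ x in 𝓝 D.b, ∀ i ∈ D.S, D.α i + 1 < D.k i * x := by
    rw [eventually_all_finset]
    intro i hi
    exact (continuous_const.mul continuous_id).tendsto D.b |>.eventually_const_lt
      (D.dominated i hi)
  obtain ⟨x, ⟨hx1, hx2⟩, hx3⟩ :=
    (((h1.and h2).filter_mono nhdsWithin_le_nhds).and
      (self_mem_nhdsWithin : Set.Iio D.b ∈ 𝓝[<] D.b)).exists
  exact ⟨x, hx3, hx1, hx2⟩

/-- The factor of `G = ∏_p (1 - p^{e - ds}) factor p s`, minus `1`. -/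
noncomputable def regular (p : ℕ) (s : ℂ) : ℂ := (1 - D.main p s) * D.factor p s - 1

lemma norm_regular_le {p : ℕ} (hp : p.Prime) {x : ℝ} (hx : D.e + 1 / 2 < D.d * x) {s : ℂ}
    (hs : x ≤ s.re) :
    ‖D.regular p s‖ ≤ (p : ℝ) ^ (2 * (D.e - D.d * x)) + 2 * D.tailBound x p := by
  -- The dominant term cancels to first order; only its square and multiples of the tail remain.
  have h1 : D.regular p s = -(D.main p s) ^ 2 + (1 - D.main p s) * D.tail p s := by
    rw [regular, factor]; ring
  have hp0 : (0 : ℝ) ≤ p := by positivity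
  have h2 := D.norm_main_le hp hs
  have h3 : (p : ℝ) ^ (D.e - D.d * x) ≤ 1 :=
    Real.rpow_le_one_of_one_le_of_nonpos (by exact_mod_cast hp.one_le) (by linarith)
  have h4 : ‖1 - D.main p s‖ ≤ 2 := by
    refine (norm_sub_le _ _).trans ?_
    rw [norm_one]; linarith
  rw [h1]
  refine (norm_add_le _ _).trans (add_le_add ?_ ?_)
  · rw [norm_neg, norm_pow, mul_comm 2, Real.rpow_mul hp0]
    exact_mod_cast pow_le_pow_left₀ (norm_nonneg _) h2 2
  · rw [norm_mul]
    exact mul_le_mul h4 (D.norm_tail_le hp hs) (norm_nonneg _) (by norm_num)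

lemma summable_regular_bound {x : ℝ} (hx : D.e + 1 / 2 < D.d * x)
    (hx' : ∀ i ∈ D.S, D.α i + 1 < D.k i * x) :
    Summable fun p : Nat.Primes =>
      (p : ℝ) ^ (2 * (D.e - D.d * x)) + 2 * D.tailBound x p :=
  (Nat.Primes.summable_rpow.2 (by linarith)).add ((D.summable_tailBound hx').mul_left 2)

/-- The function `G = ∏_p (1 - p^{e - ds}) factor p s`. -/
noncomputable def G (s : ℂ) : ℂ := ∏' p : Nat.Primes, (1 + D.regular p s)

lemma differentiableOn_G {x : ℝ} (hx : D.e + 1 / 2 < D.d * x)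
    (hx' : ∀ i ∈ D.S, D.α i + 1 < D.k i * x) : DifferentiableOn ℂ D.G {s : ℂ | x < s.re} := by
  have hd : ∀ p : Nat.Primes, Differentiable ℂ (D.regular p) := fun p =>
    (((differentiable_const _).sub (D.differentiable_main p.2)).mul
      (D.differentiable_factor p.2)).sub (differentiable_const _)
  have h := Summable.hasProdLocallyUniformlyOn_one_add (f := fun p : Nat.Primes => D.regular p)
    (isOpen_halfPlane x) (D.summable_regular_bound hx hx')
    (Eventually.of_forall fun p s hs => D.norm_regular_le p.2 hx (le_of_lt hs))
    fun p => (hd p).continuous.continuousOn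
  rw [hasProdLocallyUniformlyOn_iff_tendstoLocallyUniformlyOn] at h
  refine h.differentiableOn (Eventually.of_forall fun t => ?_) (isOpen_halfPlane x)
  refine DifferentiableOn.fun_finsetProd fun p _ => ?_
  exact ((differentiable_const _).add (hd p)).differentiableOn

lemma main_ne_one {p : ℕ} (hp : p.Prime) {s : ℂ} (hs : D.e < D.d * s.re) : 1 - D.main p s ≠ 0 := by
  intro h
  have h1 : ‖D.main p s‖ < 1 := by
    rw [D.norm_main hp]
    exact Real.rpow_lt_one_of_one_lt_of_neg (by exact_mod_cast hp.one_lt) (by linarith)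
  rw [← sub_eq_zero.1 h] at h1
  simp at h1

/-- The real Euler factor. -/
noncomputable def realFactor (p : ℕ) (x : ℝ) : ℝ :=
  1 + (p : ℝ) ^ (D.e - D.d * x) + ∑ i ∈ D.S, D.c i p * (p : ℝ) ^ (D.α i - D.k i * x)

lemma factor_ofReal (p : ℕ) (x : ℝ) : D.factor p x = (D.realFactor p x : ℂ) := by
  have hp : (0 : ℝ) ≤ p := by positivity
  simp only [factor, main, tail, realFactor]
  push_cast [Complex.ofReal_cpow hp]
  rfl

lemma one_add_rpow_le_realFactor {p : ℕ} (hp : p.Prime) (x : ℝ) :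
    1 + (p : ℝ) ^ (D.e - D.d * x) ≤ D.realFactor p x :=
  le_add_of_nonneg_right <| Finset.sum_nonneg fun i hi =>
    mul_nonneg (D.c_nonneg i hi p hp) (by positivity)

lemma one_add_inv_le_realFactor {p : ℕ} (hp : p.Prime) :
    1 + 1 / (p : ℝ) ≤ D.realFactor p D.b := by
  have h := D.one_add_rpow_le_realFactor hp D.b
  have h1 : D.e - D.d * D.b = -1 := by linarith [D.d_mul_b]
  rwa [h1, Real.rpow_neg_one, ← one_div] at h

lemma G_b_ne_zero : D.G D.b ≠ 0 := by
  refine tprod_one_add_ne_zero_of_summable (fun p => ?_) ?_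
  · have h1 : 1 + D.regular p D.b = (1 - D.main p D.b) * D.factor p D.b := by
      rw [regular]; ring
    rw [h1]
    refine mul_ne_zero (D.main_ne_one p.2 ?_) ?_
    · rw [Complex.ofReal_re]; linarith [D.d_mul_b]
    · rw [D.factor_ofReal, Complex.ofReal_ne_zero]
      have := D.one_add_inv_le_realFactor p.2
      have : (0 : ℝ) < 1 + 1 / ((p : ℕ) : ℝ) := by positivity
      linarith
  · have hx : D.e + 1 / 2 < D.d * D.b := by linarith [D.d_mul_b]
    exact (D.summable_regular_bound hx D.dominated).of_nonneg_of_le (fun _ => norm_nonneg _)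
      fun p => D.norm_regular_le p.2 hx (by simp)

/-- The Euler factor of `ζ(ds - e)` at `p` is `(1 - p^(e - ds))⁻¹`, which undoes the multiplication
in `G`. -/
lemma zeta_mul_G {s : ℂ} (hs : D.b < s.re) :
    riemannZeta (D.d * s - D.e) * D.G s = ∏' p : Nat.Primes, D.factor p s := by
  have hd : (0 : ℝ) < D.d := by exact_mod_cast D.d_pos
  have hds : D.e + 1 < D.d * s.re := by
    rw [← D.d_mul_b]; exact mul_lt_mul_of_pos_left hs hd
  have h1 : 1 < ((D.d : ℂ) * s - D.e).re := by
    simp; linarith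
  have h2 := riemannZeta_eulerProduct_hasProd h1
  have hx : D.e + 1 / 2 < D.d * s.re := by linarith
  have hx' : ∀ i ∈ D.S, D.α i + 1 < D.k i * s.re := fun i hi => (D.dominated i hi).trans
      (mul_lt_mul_of_pos_left hs (by exact_mod_cast D.k_pos i hi))
  have h3 : HasProd (fun p : Nat.Primes => 1 + D.regular p s) (D.G s) :=
    (multipliable_one_add_of_summable
      ((D.summable_regular_bound hx hx').of_nonneg_of_le (fun _ => norm_nonneg _)
        fun p => D.norm_regular_le p.2 hx le_rfl)).hasProd
  refine ((h2.mul h3).congr_fun fun p => ?_).tprod_eq.symm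
  have h4 : ((p : ℕ) : ℂ) ^ (-((D.d : ℂ) * s - D.e)) = D.main p s := by
    rw [main]; congr 1; ring
  rw [h4, regular, add_sub_cancel, inv_mul_cancel_left₀ (D.main_ne_one p.2 (by linarith))]

theorem exists_meromorphic_continuation :
    ∃ c : ℝ, c < D.b ∧ ∃ F : ℂ → ℂ, MeromorphicOn F {s : ℂ | c < s.re} ∧
      (∀ s : ℂ, D.b < s.re → F s = ∏' p : Nat.Primes, D.factor p s) ∧
      meromorphicOrderAt F (D.b : ℂ) = -1 := by
  obtain ⟨c, hc, hx, hx'⟩ := D.exists_continuation_abscissa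
  have hd : (D.d : ℂ) ≠ 0 := by exact_mod_cast D.d_pos.ne'
  have hdb : (D.d : ℂ) * D.b = D.e + 1 := by exact_mod_cast D.d_mul_b
  have hG : ∀ s : ℂ, c < s.re → AnalyticAt ℂ D.G s := fun s hs =>
    (D.differentiableOn_G hx hx').analyticAt ((isOpen_halfPlane c).mem_nhds hs)
  have hZ : ∀ s, AnalyticAt ℂ (fun s : ℂ => riemannZeta₁ (D.d * s - D.e)) s := fun s =>
    (differentiable_riemannZeta₁.comp (by fun_prop : Differentiable ℂ
      (fun s : ℂ => (D.d : ℂ) * s - D.e))).analyticAt s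
  -- Because `dz - e - 1 = d(z - b)`, the pole of `ζ` at `1` becomes an explicit factor `(z - b)⁻¹`
  -- with analytic cofactor.
  have key : ∀ z : ℂ, z ≠ D.b → riemannZeta (D.d * z - D.e) * D.G z
      = (z - D.b) ^ (-1 : ℤ) •
        ((D.d : ℂ)⁻¹ * riemannZeta₁ (D.d * z - D.e) * D.G z) := by
    intro z hz
    have hz' : z - D.b ≠ 0 := sub_ne_zero.2 hz
    have h1 : (D.d : ℂ) * z - D.e - 1 = D.d * (z - D.b) := by linear_combination hdb
    have h2 : (D.d : ℂ) * z - D.e ≠ 1 := by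
      rw [← sub_ne_zero, h1]; exact mul_ne_zero hd hz'
    rw [riemannZeta_eq_inv_sub_mul h2, h1, mul_inv, zpow_neg_one, smul_eq_mul]
    ring
  have hmer : ∀ s : ℂ, c < s.re →
      MeromorphicAt (fun s => riemannZeta (D.d * s - D.e) * D.G s) s := by
    intro s hs
    have h1 : MeromorphicAt (fun z : ℂ => (z - D.b) ^ (-1 : ℤ) •
        ((D.d : ℂ)⁻¹ * riemannZeta₁ (D.d * z - D.e) * D.G z)) s :=
      (MeromorphicAt.zpow ((MeromorphicAt.id s).sub (MeromorphicAt.const _ s)) _).smul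
        ((analyticAt_const.mul (hZ s)).mul (hG s hs)).meromorphicAt
    refine h1.congr ?_
    have h2 : ∀ᶠ z in 𝓝[≠] s, z ≠ (D.b : ℂ) := by
      by_cases h : s = D.b
      · subst h; exact self_mem_nhdsWithin
      · exact (eventually_ne_nhds h).filter_mono nhdsWithin_le_nhds
    filter_upwards [h2] with z hz using (key z hz).symm
  refine ⟨c, hc, fun s => riemannZeta (D.d * s - D.e) * D.G s, hmer, fun s hs => D.zeta_mul_G hs, ?_⟩
  have hcb : c < (D.b : ℂ).re := by simpa using hc
  have := (meromorphicOrderAt_eq_int_iff (n := -1) (hmer D.b hcb)).2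
    ⟨fun z => (D.d : ℂ)⁻¹ * riemannZeta₁ (D.d * z - D.e) * D.G z,
      (analyticAt_const.mul (hZ _)).mul (hG _ hcb), ?_, ?_⟩
  · simpa using this
  · have h1 : (D.d : ℂ) * D.b - D.e = 1 := by linear_combination hdb
    simp only [h1, riemannZeta₁_one, mul_one]
    exact mul_ne_zero (inv_ne_zero hd) D.G_b_ne_zero
  · filter_upwards [self_mem_nhdsWithin] with z hz using key z hz

theorem eulerAbscissa_eq : eulerAbscissa D.factor = (D.b : EReal) := by
  refine sInf_image_toEReal_eq ?_ ?_
  · intro x hx s hs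
    exact primeProdConverges_of_summable (D.summable_norm_factor_sub_one (lt_trans hx hs))
  · intro x hx
    by_contra h
    exact not_primeProdConverges (fun p _ => D.factor_ofReal p D.b)
      (fun p hp => D.one_add_inv_le_realFactor hp) (hx D.b (by simpa using h))

/-! ### The Dirichlet series -/

/-- The coefficient of `p^{-js}` in the Euler factor. -/
noncomputable def coef (p j : ℕ) : ℝ :=
  (if j = 0 then 1 else 0) + (if j = D.d then (p : ℝ) ^ D.e else 0) +
    ∑ i ∈ D.S, if j = D.k i then D.c i p * (p : ℝ) ^ D.α i else 0

lemma coef_nonneg {p : ℕ} (hp : p.Prime) (j : ℕ) : 0 ≤ D.coef p j := by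
  refine add_nonneg (add_nonneg ?_ ?_) (Finset.sum_nonneg fun i hi => ?_)
  · split_ifs <;> norm_num
  · split_ifs <;> positivity
  · split_ifs
    · exact mul_nonneg (D.c_nonneg i hi p hp) (by positivity)
    · exact le_rfl

lemma coef_zero (p : ℕ) : D.coef p 0 = 1 := by
  have h1 : (0 : ℕ) ≠ D.d := D.d_pos.ne
  rw [coef, if_pos rfl, if_neg h1, Finset.sum_eq_zero]
  · ring
  · intro i hi
    exact if_neg (D.k_pos i hi).ne

lemma rpow_e_le_coef {p : ℕ} (hp : p.Prime) : (p : ℝ) ^ D.e ≤ D.coef p D.d := by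
  rw [coef, if_pos rfl, if_neg D.d_pos.ne', zero_add]
  refine le_add_of_nonneg_right (Finset.sum_nonneg fun i hi => ?_)
  split_ifs
  · exact mul_nonneg (D.c_nonneg i hi p hp) (by positivity)
  · exact le_rfl

/-- The coefficients of the Dirichlet series. -/
noncomputable def coeff (m : ℕ) : ℝ := if m = 0 then 0 else m.factorization.prod D.coef

lemma coeff_nonneg (m : ℕ) : 0 ≤ D.coeff m := by
  rw [coeff]
  split_ifs with h
  · exact le_rfl
  · refine Finset.prod_nonneg fun p hp => D.coef_nonneg ?_ _
    exact Nat.prime_of_mem_primeFactors (by simpa using hp)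

lemma coeff_one : D.coeff 1 = 1 := by simp [coeff]

lemma coeff_mul {m n : ℕ} (h : m.Coprime n) : D.coeff (m * n) = D.coeff m * D.coeff n := by
  by_cases hm : m = 0
  · simp [coeff, hm]
  by_cases hn : n = 0
  · simp [coeff, hn]
  rw [coeff, coeff, coeff, if_neg (mul_ne_zero hm hn), if_neg hm, if_neg hn,
    Nat.factorization_mul_of_coprime h,
    Finsupp.prod_add_index_of_disjoint (by simpa using h.disjoint_primeFactors)]

lemma coeff_prime_pow {p : ℕ} (hp : p.Prime) (j : ℕ) : D.coeff (p ^ j) = D.coef p j := by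
  rw [coeff, if_neg (pow_ne_zero _ hp.ne_zero), hp.factorization_pow,
    Finsupp.prod_single_index (D.coef_zero p)]

/-- The general term of the Dirichlet series. -/
noncomputable abbrev term (s : ℂ) (m : ℕ) : ℂ := LSeries.term (fun m => (D.coeff m : ℂ)) s m

lemma term_mul (s : ℂ) {m n : ℕ} (h : m.Coprime n) :
    D.term s (m * n) = D.term s m * D.term s n := by
  by_cases hm : m = 0
  · simp [hm]
  by_cases hn : n = 0
  · simp [hn]
  simp only [term]
  rw [LSeries.term_of_ne_zero (mul_ne_zero hm hn), LSeries.term_of_ne_zero hm,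
    LSeries.term_of_ne_zero hn, D.coeff_mul h, Nat.cast_mul, Complex.natCast_mul_natCast_cpow]
  push_cast
  rw [mul_div_mul_comm]

lemma term_one (s : ℂ) : D.term s 1 = 1 := by
  simp [term, D.coeff_one]

lemma term_prime_pow (s : ℂ) {p : ℕ} (hp : p.Prime) (j : ℕ) :
    D.term s (p ^ j) = (if j = 0 then 1 else 0) + (if j = D.d then D.main p s else 0) +
      ∑ i ∈ D.S, if j = D.k i then (D.c i p : ℂ) * (p : ℂ) ^ ((D.α i : ℂ) - D.k i * s) else 0 := by
  have hp0 : (p : ℂ) ≠ 0 := by exact_mod_cast hp.ne_zero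
  have hpr : (0 : ℝ) ≤ p := by positivity
  have hpow : ∀ k : ℕ, (((p ^ k : ℕ) : ℂ) ^ s) = (p : ℂ) ^ ((k : ℂ) * s) := by
    intro k
    rw [Nat.cast_pow, ← Complex.natCast_cpow_natCast_mul]
  simp only [term]
  rw [LSeries.term_of_ne_zero (pow_ne_zero _ hp.ne_zero), D.coeff_prime_pow hp, coef, hpow]
  push_cast
  rw [add_div, add_div, Finset.sum_div]
  congr 1
  · congr 1
    · split_ifs with h <;> simp [h]
    · split_ifs with h
      · rw [main, Complex.cpow_sub _ _ hp0, h, Complex.ofReal_cpow hpr]; simp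
      · simp
  · refine Finset.sum_congr rfl fun i _ => ?_
    split_ifs with h
    · rw [Complex.cpow_sub _ _ hp0, h, ← mul_div_assoc]
      push_cast [Complex.ofReal_cpow hpr]
      rfl
    · simp

lemma hasSum_term_prime_pow (s : ℂ) {p : ℕ} (hp : p.Prime) :
    HasSum (fun j => D.term s (p ^ j)) (D.factor p s) := by
  simp only [D.term_prime_pow s hp]
  exact ((hasSum_ite_eq 0 1).add (hasSum_ite_eq D.d _)).add
    (hasSum_sum fun i _ => hasSum_ite_eq (D.k i) _)

open scoped ComplexOrder in
lemma term_nonneg (x : ℝ) (m : ℕ) : 0 ≤ D.term x m :=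
  LSeries.term_nonneg (by exact_mod_cast D.coeff_nonneg m) x

/-- The general term at a real point. -/
noncomputable def realTerm (x : ℝ) (m : ℕ) : ℝ := (D.term x m).re

open scoped ComplexOrder in
lemma ofReal_realTerm (x : ℝ) (m : ℕ) : (D.realTerm x m : ℂ) = D.term x m :=
  (Complex.eq_re_of_ofReal_le (r := 0) (by simpa using D.term_nonneg x m)).symm

open scoped ComplexOrder in
lemma realTerm_nonneg (x : ℝ) (m : ℕ) : 0 ≤ D.realTerm x m := by
  have := D.term_nonneg x m
  rw [← D.ofReal_realTerm] at this
  exact_mod_cast this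

lemma hasSum_realTerm_prime_pow (x : ℝ) {p : ℕ} (hp : p.Prime) :
    HasSum (fun j => D.realTerm x (p ^ j)) (D.realFactor p x) := by
  have := D.hasSum_term_prime_pow x hp
  rw [D.factor_ofReal] at this
  simp only [← D.ofReal_realTerm] at this
  exact Complex.hasSum_ofReal.1 this

/-- The Euler product formula for a series presupposes its summability, so the partial sums are
bounded directly: those up to `N` are at most the sum over `N`-smooth numbers, a finite product of
factors, which is at most `exp (∑ (factor - 1))`. -/
lemma summable_realTerm {x : ℝ} (hx : D.b < x) : Summable (D.realTerm x) := by
  have hone : D.realTerm x 1 = 1 := by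
    have := D.ofReal_realTerm x 1
    rw [D.term_one] at this
    exact_mod_cast this
  have hmul : ∀ {m n : ℕ}, m.Coprime n → D.realTerm x (m * n) = D.realTerm x m * D.realTerm x n := by
    intro m n h
    have := D.term_mul x h
    simp only [← D.ofReal_realTerm] at this
    exact_mod_cast this
  have hsum : Summable fun p : Nat.Primes => D.realFactor p x - 1 := by
    have h : Summable fun p : Nat.Primes => ‖D.factor p x - 1‖ :=
      D.summable_norm_factor_sub_one (by simpa using hx)
    refine Summable.of_norm (h.congr fun p => ?_)
    rw [D.factor_ofReal, ← Complex.ofReal_one, ← Complex.ofReal_sub, Complex.norm_real]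
  have hnn : ∀ p : ℕ, p.Prime → 0 ≤ D.realFactor p x - 1 := fun p hp => by
    have := D.one_add_rpow_le_realFactor hp x
    have : 0 ≤ (p : ℝ) ^ (D.e - D.d * x) := by positivity
    linarith
  have hsum' := (Nat.Primes.summable_iff_summable_ite fun n => D.realFactor n x - 1).1 hsum
  refine summable_of_sum_range_le
    (c := Real.exp (∑' n : ℕ, if n.Prime then D.realFactor n x - 1 else 0))
    (D.realTerm_nonneg x) fun N => ?_
  obtain ⟨h1, h2⟩ := EulerProduct.summable_and_hasSum_smoothNumbers_prod_primesBelow_tsum hone hmul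
    (fun hp => by simpa [abs_of_nonneg (D.realTerm_nonneg x _)]
      using (D.hasSum_realTerm_prime_pow x hp).summable) N
  have h3 : ∑ m ∈ Finset.range N, D.realTerm x m
      ≤ ∏ p ∈ N.primesBelow, ∑' j, D.realTerm x (p ^ j) := by
    have h4 : HasSum ((N.smoothNumbers).indicator (D.realTerm x))
        (∏ p ∈ N.primesBelow, ∑' j, D.realTerm x (p ^ j)) := hasSum_subtype_iff_indicator.1 h2
    have h5 : ∑ m ∈ Finset.range N, D.realTerm x m
        = ∑ m ∈ Finset.range N, (N.smoothNumbers).indicator (D.realTerm x) m := by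
      refine Finset.sum_congr rfl fun m hm => ?_
      rcases Nat.eq_zero_or_pos m with rfl | hm0
      · have : D.realTerm x 0 = 0 := by simp [realTerm]
        simp [Set.indicator_apply, this]
      · rw [Set.indicator_of_mem (Nat.mem_smoothNumbers_of_lt hm0 (Finset.mem_range.1 hm))]
    rw [h5]
    exact sum_le_hasSum _ (fun m _ => Set.indicator_nonneg (fun m _ => D.realTerm_nonneg x m) m) h4
  refine h3.trans ?_
  have h6 : ∏ p ∈ N.primesBelow, ∑' j, D.realTerm x (p ^ j)
      ≤ Real.exp (∑ p ∈ N.primesBelow, (D.realFactor p x - 1)) := by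
    rw [Real.exp_sum]
    refine Finset.prod_le_prod (fun p _ => tsum_nonneg fun j => D.realTerm_nonneg x _) fun p hp => ?_
    rw [(D.hasSum_realTerm_prime_pow x (Nat.prime_of_mem_primesBelow hp)).tsum_eq]
    linarith [Real.add_one_le_exp (D.realFactor p x - 1)]
  refine h6.trans (Real.exp_le_exp.2 ?_)
  rw [Nat.primesBelow, Finset.sum_filter]
  refine hsum'.sum_le_tsum _ fun n _ => ?_
  split_ifs with h
  · exact hnn n h
  · exact le_rfl

lemma lseriesHasSum {s : ℂ} (hs : D.b < s.re) :
    LSeriesHasSum (fun m => (D.coeff m : ℂ)) s (∏' p : Nat.Primes, D.factor p s) := by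
  have h1 : LSeriesSummable (fun m => (D.coeff m : ℂ)) (s.re : ℂ) := by
    have := Complex.hasSum_ofReal.2 (D.summable_realTerm hs).hasSum
    simp only [D.ofReal_realTerm] at this
    exact this.summable
  have h2 : LSeriesSummable (fun m => (D.coeff m : ℂ)) s := h1.of_re_le_re (by simp)
  have h3 : HasSum (D.term s) (∑' m, D.term s m) := Summable.hasSum h2
  have h4 := EulerProduct.eulerProduct_tprod (D.term_one s) (D.term_mul s) h2.norm
    (by simp [term])
  rw [← h4] at h3
  have h5 : (fun p : Nat.Primes => ∑' j, D.term s ((p : ℕ) ^ j)) = fun p : Nat.Primes => D.factor p s :=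
    funext fun p : Nat.Primes => (D.hasSum_term_prime_pow s p.2).tsum_eq
  rw [h5] at h3
  exact h3

/-- The terms at `m = p^d` alone are at least `p^e / p^(db) = 1/p`. -/
lemma not_lseriesSummable_b : ¬ LSeriesSummable (fun m => (D.coeff m : ℂ)) (D.b : ℂ) := by
  intro h
  apply Nat.Primes.not_summable_one_div
  have h1 : Summable (D.realTerm D.b) := by
    have h' : Summable (D.term D.b) := h
    rw [← Complex.summable_ofReal]
    simpa only [D.ofReal_realTerm] using h'
  have hinj : Function.Injective fun p : Nat.Primes => (p : ℕ) ^ D.d := fun p q hpq =>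
    Nat.Primes.coe_nat_injective (Nat.pow_left_injective D.d_pos.ne' hpq)
  refine (h1.comp_injective hinj).of_nonneg_of_le (fun _ => by positivity) fun p => ?_
  have hp0 : (0 : ℝ) < (p : ℕ) := by exact_mod_cast p.2.pos
  have h2 : D.realTerm D.b ((p : ℕ) ^ D.d) = D.coef p D.d / ((p : ℕ) : ℝ) ^ (D.d * D.b) := by
    apply Complex.ofReal_injective
    rw [D.ofReal_realTerm, term, LSeries.term_of_ne_zero (pow_ne_zero _ p.2.ne_zero),
      D.coeff_prime_pow p.2, Nat.cast_pow, ← Complex.natCast_cpow_natCast_mul]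
    push_cast [Complex.ofReal_cpow hp0.le]
    rfl
  simp only [Function.comp, h2]
  rw [D.d_mul_b, div_le_div_iff₀ hp0 (by positivity), one_mul, Real.rpow_add_one hp0.ne']
  exact mul_le_mul_of_nonneg_right (D.rpow_e_le_coef p.2) hp0.le

lemma b_le_of_lseriesSummable {x : ℝ}
    (h : LSeriesSummable (fun m => (D.coeff m : ℂ)) (x : ℂ)) : D.b ≤ x := by
  by_contra hx
  exact D.not_lseriesSummable_b (h.of_re_le_re (by simpa using (not_le.1 hx).le))

theorem abscissaOfAbsConv_eq :
    LSeries.abscissaOfAbsConv (fun m => (D.coeff m : ℂ)) = (D.b : EReal) :=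
  sInf_image_toEReal_eq (fun _ hx => (D.lseriesHasSum (by simpa using hx)).LSeriesSummable)
    fun _ hx => D.b_le_of_lseriesSummable hx

/-- At a real point all terms are nonnegative, so convergence of the partial sums is already
absolute convergence. -/
theorem dirichletAbscissa_eq :
    dirichletAbscissa (fun m => (D.coeff m : ℂ)) = (D.b : EReal) := by
  refine sInf_image_toEReal_eq (fun x hx =>
    ⟨_, HasSum.tendsto_sum_nat (D.lseriesHasSum (s := x) (by simpa using hx))⟩) ?_
  rintro x ⟨L, hL⟩
  refine D.b_le_of_lseriesSummable ?_
  have h1 : Tendsto (fun N => ∑ m ∈ Finset.range N, D.realTerm x m) atTop (𝓝 L.re) := by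
    refine ((Complex.continuous_re.tendsto L).comp hL).congr fun N => ?_
    simp [realTerm]
  have h2 := (hasSum_iff_tendsto_nat_of_nonneg (D.realTerm_nonneg x) _).2 h1
  have h3 := (Complex.hasSum_ofReal.2 h2).summable
  simp only [D.ofReal_realTerm] at h3
  exact h3

end EulerData

/-! ### Nonnegativity of `w` on `0 < q < 1` -/

lemma pred_insert_of_le {I : Finset ℕ} {i m : ℕ} (h : i ≤ m) : pred (insert m I) i = pred I i := by
  unfold pred
  rw [Finset.filter_insert, if_neg (by omega)]

lemma pred_insert_succ {I : Finset ℕ} {m : ℕ} (h : ∀ i ∈ I, i ≤ m) :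
    pred (insert m I) (m + 1) = m := by
  unfold pred
  rw [Finset.filter_insert, if_pos (by omega), Finset.sup_insert]
  exact sup_eq_left.2 (Finset.sup_le fun i hi => h i (Finset.mem_filter.1 hi).1)

lemma pred_succ_of_notMem {I : Finset ℕ} {m : ℕ} (h : m ∉ I) : pred I (m + 1) = pred I m := by
  unfold pred
  congr 1
  refine Finset.filter_congr fun i hi => ?_
  have : i ≠ m := fun h' => h (h' ▸ hi)
  omega

lemma pred_lt (I : Finset ℕ) {m : ℕ} (hm : 0 < m) : pred I m < m := by
  unfold pred
  rw [Finset.sup_lt_iff (by simpa using hm)]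
  exact fun i hi => (Finset.mem_filter.1 hi).2

/-- The real version of `phi`. -/
noncomputable def realPhi (i : ℕ) (q : ℝ) : ℝ := ∏ j ∈ Finset.Icc 1 i, (q ^ j - 1)

lemma phi_ofReal (i : ℕ) (q : ℝ) : phi i q = (realPhi i q : ℂ) := by
  simp [phi, realPhi]

lemma realPhi_zero (q : ℝ) : realPhi 0 q = 1 := by simp [realPhi]

lemma realPhi_succ (i : ℕ) (q : ℝ) : realPhi (i + 1) q = realPhi i q * (q ^ (i + 1) - 1) := by
  rw [realPhi, realPhi, Finset.prod_Icc_succ_top (by omega)]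

lemma realPhi_eq_pred_mul {r : ℕ} (q : ℝ) (hr : 0 < r) :
    realPhi r q = realPhi (r - 1) q * (q ^ r - 1) := by
  obtain ⟨r, rfl⟩ := Nat.exists_eq_succ_of_ne_zero hr.ne'
  exact realPhi_succ r q

lemma realPhi_ne_zero (i : ℕ) {q : ℝ} (h0 : 0 < q) (h1 : q < 1) : realPhi i q ≠ 0 := by
  refine Finset.prod_ne_zero_iff.2 fun j hj => sub_ne_zero.2 (ne_of_lt ?_)
  exact pow_lt_one₀ h0.le h1 (by have := (Finset.mem_Icc.1 hj).1; omega)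

lemma neg_one_pow_mul_realPhi_pos (i : ℕ) {q : ℝ} (h0 : 0 < q) (h1 : q < 1) :
    0 < (-1) ^ i * realPhi i q := by
  induction i with
  | zero => simp [realPhi_zero]
  | succ i ih =>
    have : q ^ (i + 1) < 1 := pow_lt_one₀ h0.le h1 (by omega)
    rw [realPhi_succ, pow_succ]
    have h2 : (-1 : ℝ) ^ i * -1 * (realPhi i q * (q ^ (i + 1) - 1))
        = (-1) ^ i * realPhi i q * (1 - q ^ (i + 1)) := by ring
    rw [h2]
    exact mul_pos ih (by linarith)

/-- The product of the `φ_{i_ν - i_{ν-1}}(q)⁻¹` over `ν ≤ r`. -/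
noncomputable def blockProd (I : Finset ℕ) (q : ℝ) : ℝ := ∏ i ∈ I, (realPhi (i - pred I i) q)⁻¹

lemma blockProd_insert {I : Finset ℕ} {m : ℕ} (h : ∀ i ∈ I, i < m) (q : ℝ) :
    blockProd (insert m I) q = (realPhi (m - pred I m) q)⁻¹ * blockProd I q := by
  have hm : m ∉ I := fun h' => lt_irrefl _ (h m h')
  rw [blockProd, Finset.prod_insert hm, pred_insert_of_le le_rfl, blockProd]
  congr 1
  exact Finset.prod_congr rfl fun i hi => by rw [pred_insert_of_le (h i hi).le]

/-- The real version of `w`. -/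
noncomputable def realW (ℓ : ℕ) (K : Finset ℕ) (q : ℝ) : ℝ :=
  ∑ I ∈ K.powerset, (-1) ^ (K \ I).card *
    (realPhi ℓ q * ((realPhi (ℓ - pred I ℓ) q)⁻¹ * blockProd I q))

lemma w_ofReal {ℓ : ℕ} {K : Finset ℕ} (hK : ∀ i ∈ K, i < ℓ) (q : ℝ) :
    w ℓ K q = (realW ℓ K q : ℂ) := by
  rw [w, realW]
  push_cast
  refine Finset.sum_congr rfl fun I hI => ?_
  have hI' : ∀ i ∈ I, i < ℓ := fun i hi => hK i (Finset.mem_powerset.1 hI hi)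
  rw [phiSet, Finset.prod_insert fun h => lt_irrefl _ (hI' ℓ h), phi_ofReal, phi_ofReal, blockProd]
  simp only [phi_ofReal]
  push_cast
  rw [Finset.prod_inv_distrib, div_eq_mul_inv, mul_inv]

lemma realW_empty (ℓ : ℕ) {q : ℝ} (h0 : 0 < q) (h1 : q < 1) : realW ℓ ∅ q = 1 := by
  simp [realW, blockProd, pred, realPhi_ne_zero ℓ h0 h1]

/-- The generating function, up to a factor, of the sequences `x_1, …, x_ℓ` of natural numbers with
last term `t` and strict ascents exactly at the places in `K`. -/
noncomputable def ribbon (ℓ : ℕ) (K : Finset ℕ) (q : ℝ) (t : ℕ) : ℝ :=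
  -- Inclusion–exclusion over the places where an ascent is allowed. For a given `I` the sequence is
  -- weakly decreasing on each block, and the weight is `q^(x_1 + ⋯ + x_ℓ)`. The last block, of
  -- length `r`, has all its terms at least `t`, whence `q^(rt)` and `φ_(r-1)`. The sign left over
  -- is `(-1)^(ℓ-1)`.
  ∑ I ∈ K.powerset, (-1) ^ (K \ I).card *
    (blockProd I q * ((q ^ (ℓ - pred I ℓ)) ^ t / realPhi (ℓ - pred I ℓ - 1) q))

section

variable {m : ℕ} {K : Finset ℕ} {q : ℝ} (h0 : 0 < q) (h1 : q < 1)
include h0 h1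

/-- The geometric series in `q^r`, with `r` the length of the last block, turns `φ_(r-1)` into `φ_r`
with a sign. -/
lemma hasSum_ribbon_add (hm : 0 < m) (t : ℕ) :
    HasSum (fun s => ribbon m K q (t + s))
      (∑ I ∈ K.powerset, (-1) ^ (K \ I).card *
        (blockProd I q * (-(q ^ (m - pred I m)) ^ t / realPhi (m - pred I m) q))) := by
  refine hasSum_sum fun I _ => HasSum.mul_left _ (HasSum.mul_left _ ?_)
  have hr : 0 < m - pred I m := by have := pred_lt I hm; omega
  set r := m - pred I m
  have hq : q ^ r < 1 := pow_lt_one₀ h0.le h1 hr.ne'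
  have h2 := ((hasSum_geometric_of_lt_one (pow_pos h0 r).le hq).mul_left
    ((q ^ r) ^ t / realPhi (r - 1) q))
  have h3 := realPhi_ne_zero (r - 1) h0 h1
  have h4 : q ^ r - 1 ≠ 0 := by linarith
  have h4' : 1 - q ^ r ≠ 0 := by linarith
  convert h2 using 1
  · ext s; rw [pow_add]; ring
  · rw [realPhi_eq_pred_mul q hr]
    field_simp
    ring

/-- No ascent at `m` means `x_m ≥ x_(m+1) = t`, so the previous term runs over all `t + s`. -/
lemma ribbon_succ_of_notMem (hm : 0 < m) (hK : ∀ i ∈ K, i < m) (t : ℕ) :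
    HasSum (fun s => -q ^ t * ribbon m K q (t + s)) (ribbon (m + 1) K q t) := by
  suffices h : ribbon (m + 1) K q t = -q ^ t * _ from
    h ▸ (hasSum_ribbon_add h0 h1 hm t).mul_left (-q ^ t)
  rw [ribbon, Finset.mul_sum]
  refine Finset.sum_congr rfl fun I hI => ?_
  have hmI : m ∉ I := fun h => lt_irrefl _ (hK m (Finset.mem_powerset.1 hI h))
  have hr := pred_lt I hm
  rw [pred_succ_of_notMem hmI, show m + 1 - pred I m - 1 = m - pred I m by omega,
    show m + 1 - pred I m = m - pred I m + 1 by omega, pow_succ q, mul_pow]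
  ring

/-- An ascent at `m` means `x_m < x_(m+1) = t`. In the sum, `I` and `I ∪ {m}` are paired, and their
difference is a finite geometric sum. -/
lemma ribbon_succ_insert (hm : 0 < m) (hK : ∀ i ∈ K, i < m) (t : ℕ) :
    ribbon (m + 1) (insert m K) q t = -q ^ t * ∑ s ∈ Finset.range t, ribbon m K q s := by
  have hmK : m ∉ K := fun h => lt_irrefl _ (hK m h)
  rw [ribbon, Finset.sum_powerset_insert hmK, ← Finset.sum_add_distrib]
  simp only [ribbon]
  rw [Finset.sum_comm, Finset.mul_sum]
  refine Finset.sum_congr rfl fun I hI => ?_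
  have hIK := Finset.mem_powerset.1 hI
  have hI' : ∀ i ∈ I, i < m := fun i hi => hK i (hIK hi)
  have hmI : m ∉ I := fun h => hmK (hIK h)
  have hr : 0 < m - pred I m := by have := pred_lt I hm; omega
  have hc1 : (insert m K \ I).card = (K \ I).card + 1 := by
    rw [Finset.insert_sdiff_of_notMem _ hmI, Finset.card_insert_of_notMem (by simp [hmK])]
  have hc2 : insert m K \ insert m I = K \ I := by
    ext i; simp only [Finset.mem_sdiff, Finset.mem_insert]
    constructor
    · tauto
    · rintro ⟨h, h'⟩
      refine ⟨Or.inr h, ?_⟩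
      rintro (rfl | h'')
      · exact hmK h
      · exact h' h''
  rw [hc1, hc2, pred_insert_succ fun i hi => (hI' i hi).le, pred_succ_of_notMem hmI,
    blockProd_insert hI', show m + 1 - pred I m - 1 = m - pred I m by omega,
    show m + 1 - pred I m = m - pred I m + 1 by omega, ← Finset.mul_sum, ← Finset.mul_sum,
    ← Finset.sum_div, show m + 1 - m = 1 by omega]
  set r := m - pred I m
  have hq : q ^ r < 1 := pow_lt_one₀ h0.le h1 hr.ne'
  have h3 := realPhi_ne_zero (r - 1) h0 h1
  have h4 : q ^ r - 1 ≠ 0 := by linarith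
  rw [geom_sum_eq hq.ne, realPhi_eq_pred_mul q hr, pow_succ q, mul_pow]
  simp only [pow_one, Nat.sub_self, realPhi_zero]
  field_simp
  ring

lemma neg_one_pow_mul_ribbon_nonneg (hK : K ⊆ Finset.Icc 1 m) (t : ℕ) :
    0 ≤ (-1) ^ m * ribbon (m + 1) K q t := by
  induction m generalizing K t with
  | zero =>
    have : K = ∅ := by simpa using hK
    subst this
    simp [ribbon, blockProd, pred, realPhi_zero]
    positivity
  | succ m ih =>
    by_cases hm : m + 1 ∈ K
    · have hKe : K.erase (m + 1) ⊆ Finset.Icc 1 m := by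
        intro i hi
        have h2 := Finset.mem_erase.1 hi
        have h3 := Finset.mem_Icc.1 (hK h2.2)
        exact Finset.mem_Icc.2 ⟨h3.1, by omega⟩
      rw [← Finset.insert_erase hm, ribbon_succ_insert h0 h1 m.succ_pos fun i hi =>
        Nat.lt_succ_of_le (Finset.mem_Icc.1 (hKe hi)).2]
      have h2 : (-1 : ℝ) ^ (m + 1) *
          (-q ^ t * ∑ s ∈ Finset.range t, ribbon (m + 1) (K.erase (m + 1)) q s)
          = q ^ t * ∑ s ∈ Finset.range t, (-1) ^ m * ribbon (m + 1) (K.erase (m + 1)) q s := by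
        rw [← Finset.mul_sum]; ring
      rw [h2]
      exact mul_nonneg (by positivity) (Finset.sum_nonneg fun s _ => ih hKe s)
    · have hKm : K ⊆ Finset.Icc 1 m := by
        intro i hi
        have h3 := Finset.mem_Icc.1 (hK hi)
        have h4 : i ≠ m + 1 := fun h => hm (h ▸ hi)
        exact Finset.mem_Icc.2 ⟨h3.1, by omega⟩
      have h2 := (ribbon_succ_of_notMem h0 h1 m.succ_pos (fun i hi =>
        Nat.lt_succ_of_le (Finset.mem_Icc.1 (hKm hi)).2) t).mul_left ((-1 : ℝ) ^ (m + 1))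
      refine h2.nonneg fun s => ?_
      have h3 : (-1 : ℝ) ^ (m + 1) * (-q ^ t * ribbon (m + 1) K q (t + s))
          = q ^ t * ((-1) ^ m * ribbon (m + 1) K q (t + s)) := by ring
      rw [h3]
      exact mul_nonneg (by positivity) (ih hKm _)

/-- `w_{ℓ,K}(q)` is nonnegative for `0 < q < 1`. -/
theorem realW_nonneg (hm : 0 < m) (hK : K ⊆ Finset.Icc 1 (m - 1)) : 0 ≤ realW m K q := by
  obtain ⟨m, rfl⟩ := Nat.exists_eq_succ_of_ne_zero hm.ne'
  -- Summing over the last term of the sequence gives `w` divided by `-φ`; the signs of `φ` and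
  -- `ribbon` then match.
  have h2 := (hasSum_ribbon_add (K := K) h0 h1 m.succ_pos 0).mul_left (-realPhi (m + 1) q)
  have h3 : realW (m + 1) K q = -realPhi (m + 1) q * ∑ I ∈ K.powerset, (-1) ^ (K \ I).card *
      (blockProd I q * (-(q ^ (m + 1 - pred I (m + 1))) ^ 0 /
        realPhi (m + 1 - pred I (m + 1)) q)) := by
    rw [realW, Finset.mul_sum]
    refine Finset.sum_congr rfl fun I _ => ?_
    rw [pow_zero]
    ring
  rw [h3]
  refine h2.nonneg fun s => ?_
  have h4 := neg_one_pow_mul_realPhi_pos (m + 1) h0 h1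
  have h5 := neg_one_pow_mul_ribbon_nonneg h0 h1 (m := m) hK (0 + s)
  have h6 : -realPhi (m + 1) q * ribbon (m + 1) K q (0 + s)
      = ((-1) ^ (m + 1) * realPhi (m + 1) q) * ((-1) ^ m * ribbon (m + 1) K q (0 + s)) := by
    have h7 : ((-1 : ℝ) ^ m) * (-1) ^ m = 1 := by rw [← mul_pow]; simp
    rw [pow_succ]
    linear_combination (realPhi (m + 1) q * ribbon (m + 1) K q (0 + s)) * h7
  rw [show m.succ = m + 1 from rfl, h6]
  exact mul_nonneg h4.le h5

end

/-! ### Boundedness of `w` on `0 < q ≤ 1/2` -/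

lemma abs_realPhi_le_one (i : ℕ) {q : ℝ} (h0 : 0 < q) (h1 : q < 1) : |realPhi i q| ≤ 1 := by
  rw [realPhi, Finset.abs_prod]
  refine Finset.prod_le_one (fun _ _ => abs_nonneg _) fun j _ => ?_
  have h2 : 0 < q ^ j := by positivity
  have h3 : q ^ j ≤ 1 := pow_le_one₀ h0.le h1.le
  rw [abs_le]
  constructor <;> linarith

lemma abs_realPhi_inv_le (i : ℕ) {q : ℝ} (h0 : 0 < q) (h1 : q ≤ 1 / 2) :
    |(realPhi i q)⁻¹| ≤ 2 ^ i := by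
  rw [realPhi, ← Finset.prod_inv_distrib, Finset.abs_prod]
  refine (Finset.prod_le_prod (g := fun _ => 2) (fun _ _ => abs_nonneg _) fun j hj => ?_).trans
    (by simp)
  have hj1 : j ≠ 0 := by have := (Finset.mem_Icc.1 hj).1; omega
  have h2 : q ^ j ≤ 1 / 2 := (pow_le_of_le_one h0.le (by linarith) hj1).trans h1
  have h3 : 0 < q ^ j := by positivity
  rw [abs_inv, abs_of_neg (by linarith)]
  rw [inv_le_comm₀ (by linarith) (by norm_num)]
  linarith

/-- A bound for `w_{ℓ,K}(q)` on `0 < q ≤ 1/2`. -/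
lemma realW_le (ℓ : ℕ) (K : Finset ℕ) : ∃ C, ∀ q : ℝ, 0 < q → q ≤ 1 / 2 → realW ℓ K q ≤ C := by
  refine ⟨∑ I ∈ K.powerset, (2 ^ (ℓ - pred I ℓ) * ∏ i ∈ I, 2 ^ (i - pred I i)), fun q h0 h1 => ?_⟩
  refine Finset.sum_le_sum fun I _ => (le_abs_self _).trans ?_
  rw [abs_mul, abs_pow, abs_neg, abs_one, one_pow, one_mul, abs_mul, abs_mul, blockProd,
    Finset.abs_prod]
  refine (mul_le_of_le_one_left (by positivity)
    (abs_realPhi_le_one ℓ h0 (by linarith))).trans ?_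
  exact mul_le_mul (abs_realPhi_inv_le _ h0 h1)
    (Finset.prod_le_prod (fun _ _ => abs_nonneg _) fun i _ => abs_realPhi_inv_le _ h0 h1)
    (by positivity) (by positivity)

/-! ### The exponents -/

lemma intCast_mul_succ_div_two (i : ℤ) : ((i * (i + 1) / 2 : ℤ) : ℝ) = i * (i + 1) / 2 := by
  rw [Int.cast_div (Int.even_mul_succ_self i).two_dvd (by norm_num)]
  push_cast
  ring

/-- The contribution of `i ∈ K` to `a(K) + A (b(K) + #K)`. -/
noncomputable def expo (ℓ : ℕ) (A : ℝ) (i : ℕ) : ℝ :=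
  (ℓ * (ℓ + 1) - i * (i + 1)) / 2 + A * (ℓ - i)

lemma aExp_add_bExp (ℓ : ℕ) (A : ℝ) (K : Finset ℕ) :
    (aExp ℓ K : ℝ) + A * bExp ℓ K + A * K.card = ∑ i ∈ K, expo ℓ A i := by
  have h : (K.card : ℝ) = ∑ _i ∈ K, (1 : ℝ) := by simp
  rw [aExp, bExp, h]
  rw [Int.cast_sum, Int.cast_sum, Finset.mul_sum, Finset.mul_sum, ← Finset.sum_add_distrib,
    ← Finset.sum_add_distrib]
  refine Finset.sum_congr rfl fun i _ => ?_
  rw [Int.cast_add, Int.cast_neg, intCast_mul_succ_div_two, intCast_mul_succ_div_two, expo]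
  push_cast
  ring

lemma bracket_insert {ℓ a : ℕ} {J : Finset ℕ} (h : ∀ x ∈ J, a < x) :
    bracket ℓ (insert a J) = ℓ - a - bracket ℓ J := by
  have ha : a ∉ J := fun h' => lt_irrefl _ (h a h')
  have h1 : ((insert a J).filter (· ≤ a)) = {a} := by
    ext x; simp only [Finset.mem_filter, Finset.mem_insert, Finset.mem_singleton]
    constructor
    · rintro ⟨rfl | hx, hx'⟩
      · rfl
      · have := h x hx; omega
    · rintro rfl; exact ⟨Or.inl rfl, le_rfl⟩
  rw [bracket, Finset.sum_insert ha, h1, bracket, Finset.card_singleton]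
  have h2 : ∀ j ∈ J, (-1 : ℤ) ^ ((insert a J).filter (· ≤ j)).card * ((j : ℤ) - ℓ)
      = -((-1) ^ (J.filter (· ≤ j)).card * ((j : ℤ) - ℓ)) := by
    intro j hj
    rw [Finset.filter_insert, if_pos (h j hj).le,
      Finset.card_insert_of_notMem (by simp [ha]), pow_succ]
    ring
  rw [Finset.sum_congr rfl h2, Finset.sum_neg_distrib]
  ring

/-- `⟨J⟩` is the alternating sum of the decreasing positive numbers `ℓ - j_ν`, hence lies between
`0` and its first term. The auxiliary `m` keeps track of the minimum of `J` through the induction.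
-/
lemma bracket_bounds {ℓ : ℕ} {J : Finset ℕ} (hJ : ∀ j ∈ J, j < ℓ) :
    0 ≤ bracket ℓ J ∧ ∀ m : ℕ, m ≤ ℓ → (∀ j ∈ J, m ≤ j) → bracket ℓ J ≤ ℓ - m := by
  induction J using Finset.induction_on_min with
  | empty => simp [bracket]
  | insert a J ha ih =>
    have haℓ : a < ℓ := hJ a (Finset.mem_insert_self a J)
    obtain ⟨h1, h2⟩ := ih fun j hj => hJ j (Finset.mem_insert_of_mem hj)
    have h3 := h2 (a + 1) haℓ fun j hj => ha j hj
    rw [bracket_insert ha]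
    push_cast at h3
    refine ⟨by omega, fun m _ hm => ?_⟩
    have := hm a (Finset.mem_insert_self a J)
    omega

/-- The exponent of `X` in the term of the total ASH polynomial with index `J, I₁`; here `C` is `B`
or `-B`. -/
noncomputable def xExp (ℓ : ℕ) (A C : ℝ) (J I₁ : Finset ℕ) : ℝ :=
  C * bracket ℓ J + ∑ i ∈ J, expo ℓ A i + 2 * ∑ i ∈ I₁, expo ℓ A i

/-- The exponent of `T` in the term with index `J, I₁` of `W^{(ω)}`. -/
def tExp (ω : ℕ) (J I₁ : Finset ℕ) : ℕ := J.card + 2 * I₁.card + (J.card + ω) % 2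

section

variable {ℓ : ℕ} {A B : ℝ}

lemma expo_le (hAB : (A = 0 ∧ B = -1) ∨ (A = -1 / 2 ∧ B = -1 / 2)) (i : ℕ) :
    expo ℓ A i ≤ expo ℓ A 0 - i / 2 := by
  have h : (i : ℝ) ≤ i * i := by exact_mod_cast Nat.le_mul_self i
  rcases hAB with ⟨rfl, -⟩ | ⟨rfl, -⟩ <;> simp only [expo, Nat.cast_zero] <;> nlinarith

lemma expo_zero_nonneg (hℓ : 0 < ℓ) (hAB : (A = 0 ∧ B = -1) ∨ (A = -1 / 2 ∧ B = -1 / 2)) :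
    0 ≤ expo ℓ A 0 := by
  have h : (1 : ℝ) ≤ ℓ := by exact_mod_cast hℓ
  rcases hAB with ⟨rfl, -⟩ | ⟨rfl, -⟩ <;> simp only [expo, Nat.cast_zero] <;> nlinarith

lemma sum_expo_le (hAB : (A = 0 ∧ B = -1) ∨ (A = -1 / 2 ∧ B = -1 / 2)) (K : Finset ℕ) :
    ∑ i ∈ K, expo ℓ A i ≤ K.card * expo ℓ A 0 - ∑ i ∈ K, (i : ℝ) / 2 := by
  have h : (K.card : ℝ) * expo ℓ A 0 = ∑ _i ∈ K, expo ℓ A 0 := by simp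
  rw [h, ← Finset.sum_sub_distrib]
  exact Finset.sum_le_sum fun i _ => expo_le hAB i

lemma bo_of_integral (ℓ : ℕ) : bo ℓ 0 (-1) = (ℓ + 1) / 2 := by
  have h : (0 : ℝ) ≤ ℓ := by positivity
  rw [bo, dim, div_mul_eq_mul_div, div_eq_iff (by linarith)]
  ring

lemma bo_mul_of_half_integral (ℓ : ℕ) :
    bo ℓ (-1 / 2) (-1 / 2) * (2 * (ℓ + 1)) = ℓ * (ℓ + 1) + 2 := by
  have h : (0 : ℝ) ≤ ℓ := by positivity
  rw [bo, dim, div_mul_eq_mul_div, div_mul_eq_mul_div, div_eq_iff (by linarith)]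
  ring

/-- `θ` is what one power of `T`, worth `(n/2) b_o`, leaves over beyond the largest contribution
`expo ℓ A 0`. The last equation says that the term `(1, {0}, ∅)` is exactly critical; `θ ≥ 1`
amounts to `b_o ≤ ℓ`. -/
lemma exists_slack (hℓ : 0 < ℓ) (hAB : (A = 0 ∧ B = -1) ∨ (A = -1 / 2 ∧ B = -1 / 2)) :
    ∃ θ : ℝ, 1 ≤ θ ∧ dim ℓ A * bo ℓ A B / 2 = expo ℓ A 0 + θ ∧ -B * bo ℓ A B + θ = -B * ℓ + 1 := by
  have h : (1 : ℝ) ≤ ℓ := by exact_mod_cast hℓ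
  refine ⟨-B * ℓ + 1 + B * bo ℓ A B, ?_, ?_, by ring⟩
  · rcases hAB with ⟨rfl, rfl⟩ | ⟨rfl, rfl⟩
    · rw [bo_of_integral]; linarith
    · have h1 := bo_mul_of_half_integral ℓ
      have h2 : bo ℓ (-1 / 2) (-1 / 2) ≤ ℓ := by nlinarith
      linarith
  · rcases hAB with ⟨rfl, rfl⟩ | ⟨rfl, rfl⟩
    · rw [bo_of_integral]
      simp only [dim, expo, Nat.cast_zero]
      ring
    · have h1 := bo_mul_of_half_integral ℓ
      simp only [dim, expo, Nat.cast_zero]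
      linear_combination h1 / 2

/-- All terms but two of the total ASH polynomial are dominated. -/
theorem xExp_add_one_lt (hℓ : 0 < ℓ) (hAB : (A = 0 ∧ B = -1) ∨ (A = -1 / 2 ∧ B = -1 / 2))
    {J I₁ : Finset ℕ} (hJ : ∀ j ∈ J, j < ℓ) {ω : ℕ} (hω : ω < 2)
    (h₀ : ¬ (ω = 0 ∧ J = ∅ ∧ I₁ = ∅)) (h₁ : ¬ (ω = 1 ∧ J = {0} ∧ I₁ = ∅)) :
    xExp ℓ A (if ω = 0 then B else -B) J I₁ + 1
      < (dim ℓ A * tExp ω J I₁ + ω * (-2 * B)) / 2 * bo ℓ A B := by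
  obtain ⟨θ, hθ, hdim, hbo⟩ := exists_slack hℓ hAB
  have hg := expo_zero_nonneg hℓ hAB
  have hB : 0 < -B := by rcases hAB with ⟨-, rfl⟩ | ⟨-, rfl⟩ <;> norm_num
  have hs := sum_expo_le (ℓ := ℓ) hAB J
  have hs₁ := sum_expo_le (ℓ := ℓ) hAB I₁
  have hi : 0 ≤ ∑ i ∈ J, (i : ℝ) / 2 := Finset.sum_nonneg fun _ _ => by positivity
  have hi₁ : 0 ≤ ∑ i ∈ I₁, (i : ℝ) / 2 := Finset.sum_nonneg fun _ _ => by positivity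
  obtain ⟨hb0, hb1⟩ := bracket_bounds hJ
  have hb0' : (0 : ℝ) ≤ bracket ℓ J := by exact_mod_cast hb0
  have hτ : (tExp ω J I₁ : ℝ) = J.card + 2 * I₁.card + ((J.card + ω) % 2 : ℕ) := by
    rw [tExp]; push_cast; ring
  have hδ : 0 ≤ (((J.card + ω) % 2 : ℕ) : ℝ) * expo ℓ A 0 := by positivity
  have hrhs : (dim ℓ A * tExp ω J I₁ + ω * (-2 * B)) / 2 * bo ℓ A B
      = tExp ω J I₁ * (expo ℓ A 0 + θ) + ω * (-B * bo ℓ A B) := by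
    rw [← hdim]; ring
  have hgτ : (tExp ω J I₁ : ℝ) * expo ℓ A 0 = J.card * expo ℓ A 0 + 2 * (I₁.card * expo ℓ A 0)
      + (((J.card + ω) % 2 : ℕ) : ℝ) * expo ℓ A 0 := by
    rw [hτ]; ring
  -- What remains after comparing each contribution with `expo ℓ A 0`. For `ω = 0` the bracket
  -- enters with a negative coefficient and `tExp ≥ 2`. For `ω = 1` the left side is at most `-Bℓ +
  -- 1`, the critical value; equality is excluded by a second power of `T`, or else by `J = ∅` or `J
  -- = {j}` with `j ≥ 1`.
  have key : (if ω = 0 then B else -B) * bracket ℓ J - ∑ i ∈ J, (i : ℝ) / 2 + 1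
      < tExp ω J I₁ * θ + ω * (-B * bo ℓ A B) := by
    rcases Nat.lt_succ_iff_lt_or_eq.1 hω with h | rfl
    · obtain rfl : ω = 0 := by omega
      have h2 : 2 ≤ tExp 0 J I₁ := by
        have : ¬ (J.card = 0 ∧ I₁.card = 0) := by
          simpa [Finset.card_eq_zero] using h₀
        rw [tExp]; omega
      have h2' : (2 : ℝ) ≤ tExp 0 J I₁ := by exact_mod_cast h2
      have h3 : 0 ≤ -B * bracket ℓ J := mul_nonneg hB.le hb0'
      simp only [if_true, Nat.cast_zero, zero_mul, add_zero]
      nlinarith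
    · simp only [one_ne_zero, if_false, Nat.cast_one, one_mul]
      have hbℓ : (bracket ℓ J : ℝ) ≤ ℓ := by
        have := hb1 0 (Nat.zero_le _) fun _ _ => Nat.zero_le _
        have h' : bracket ℓ J ≤ ℓ := by omega
        exact_mod_cast h'
      have h3 : -B * bracket ℓ J ≤ -B * ℓ := mul_le_mul_of_nonneg_left hbℓ hB.le
      rcases Nat.lt_or_ge (tExp 1 J I₁) 2 with ht | ht
      · have hc : I₁.card = 0 ∧ J.card ≤ 1 ∧ tExp 1 J I₁ = 1 := by
          rw [tExp] at ht ⊢; omega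
        have hI : I₁ = ∅ := Finset.card_eq_zero.1 hc.1
        rw [hc.2.2]
        rcases Finset.card_le_one_iff_subset_singleton.1 hc.2.1 with ⟨j, hj⟩
        rcases Finset.subset_singleton_iff.1 hj with rfl | rfl
        · have : (0 : ℝ) < -B * ℓ := mul_pos hB (by exact_mod_cast hℓ)
          simp only [bracket, Finset.sum_empty, Int.cast_zero, mul_zero, Nat.cast_one]
          linarith
        · have hj0 : 1 ≤ j := by
            by_contra h
            exact h₁ ⟨rfl, by rw [show j = 0 by omega], hI⟩
          have h4 := hb1 j (hJ j (by simp)).le (by simp)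
          have h5 : (bracket ℓ {j} : ℝ) ≤ ℓ - j := by exact_mod_cast h4
          have h6 : (1 : ℝ) ≤ j := by exact_mod_cast hj0
          have h7 := mul_le_mul_of_nonneg_left h5 hB.le
          have h8 : 0 < -B * j := mul_pos hB (by linarith)
          rw [Finset.sum_singleton, Nat.cast_one]
          linarith
      · have ht' : (2 : ℝ) ≤ tExp 1 J I₁ := by exact_mod_cast ht
        nlinarith
  rw [hrhs, xExp, mul_add, hgτ]
  linarith

end

/-! ### The Euler factor as a sum of monomials -/

/-- Every outer exponent is an integer, so the complex powers combine without any choice of branch.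
-/
lemma monomial_eq {X : ℂ} (hX : X ≠ 0) (s A c : ℂ) (bJ aJ b₁ a₁ : ℤ) (j i₁ δ n ω m : ℕ) :
    X ^ c * ((X ^ A) ^ bJ * X ^ aJ * (X ^ a₁ * (X ^ A) ^ b₁ *
      (X ^ A * (X ^ (-s / 2)) ^ n) ^ i₁) ^ 2) * (X ^ A * (X ^ (-s / 2)) ^ n) ^ j *
      ((X ^ (-s / 2)) ^ n) ^ δ * ((X ^ (-s / 2)) ^ m) ^ ω
    = X ^ (c + (aJ + A * bJ + A * j) + 2 * (a₁ + A * b₁ + A * i₁) -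
        (n * (j + 2 * i₁ + δ) + ω * m) / 2 * s) := by
  simp only [← Complex.cpow_intCast X, Complex.cpow_def_of_ne_zero hX,
    ← Complex.exp_int_mul, ← Complex.exp_nat_mul, ← Complex.exp_add]
  congr 1
  push_cast
  ring

/-- Merges both parities into one sum: the extra `T'` occurs exactly when `#J` and `ω` differ in
parity. -/
lemma U_add_U_mul (ω : ℕ) (hω : ω < 2) (ℓ : ℕ) (C : ℝ) (X u T T' : ℂ) :
    U ω ℓ C X u T + U (1 - ω) ℓ C X u T * T' = ∑ J ∈ (Finset.range ℓ).powerset,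
      X ^ ((C * bracket ℓ J : ℝ) : ℂ) * scriptU ℓ J X u T * T ^ J.card *
        T' ^ ((J.card + ω) % 2) := by
  rw [← Finset.sum_filter_add_sum_filter_not _ (fun J => J.card ≡ ω [MOD 2])]
  have h : ((Finset.range ℓ).powerset.filter fun J => J.card ≡ 1 - ω [MOD 2])
      = (Finset.range ℓ).powerset.filter fun J => ¬ J.card ≡ ω [MOD 2] := by
    refine Finset.filter_congr fun J _ => ?_
    unfold Nat.ModEq
    omega
  rw [U, U, h, Finset.sum_mul]
  congr 1
  · refine Finset.sum_congr rfl fun J hJ => ?_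
    have := (Finset.mem_filter.1 hJ).2
    unfold Nat.ModEq at this
    rw [show (J.card + ω) % 2 = 0 by omega, pow_zero, mul_one]
  · refine Finset.sum_congr rfl fun J hJ => ?_
    have := (Finset.mem_filter.1 hJ).2
    unfold Nat.ModEq at this
    rw [show (J.card + ω) % 2 = 1 by omega, pow_one]

/-- The indices of the terms of the total ASH polynomial. -/
abbrev Index : Type := (_ : ℕ) × (_ : Finset ℕ) × Finset ℕ × Finset ℕ

/-- The set of indices `(ω, J, I₀, I₁)`, where `ω` is the upper index of `W^{(ω)}`. -/
def indices (ℓ : ℕ) : Finset Index :=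
  (Finset.range 2).sigma fun _ => (Finset.range ℓ).powerset.sigma fun J =>
    (J ∩ Finset.Icc 1 (ℓ - 1)).powerset ×ˢ (Finset.Icc 1 (ℓ - 1) \ J).powerset

lemma mem_indices {ℓ : ℕ} {i : Index} : i ∈ indices ℓ ↔ i.1 < 2 ∧ i.2.1 ⊆ Finset.range ℓ ∧
    i.2.2.1 ⊆ i.2.1 ∩ Finset.Icc 1 (ℓ - 1) ∧ i.2.2.2 ⊆ Finset.Icc 1 (ℓ - 1) \ i.2.1 := by
  simp only [indices, Finset.mem_sigma, Finset.mem_range, Finset.mem_powerset, Finset.mem_product]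

lemma Wtotal_eq {ℓ n m : ℕ} {A B : ℝ} (hn : dim ℓ A = n) (hm : -2 * B = m) {X : ℂ} (hX : X ≠ 0)
    (s : ℂ) :
    Wtotal ℓ A B X (X ^ (-s / 2)) = ∑ i ∈ indices ℓ, w ℓ (i.2.2.1 ∪ i.2.2.2) X⁻¹ *
      X ^ ((xExp ℓ A (if i.1 = 0 then B else -B) i.2.1 i.2.2.2 : ℂ) -
        ((n * tExp i.1 i.2.1 i.2.2.2 + i.1 * m : ℕ) : ℂ) / 2 * s) := by
  have hW0 := U_add_U_mul 0 (by norm_num) ℓ B X (X ^ (A : ℂ)) (X ^ (A : ℂ) * (X ^ (-s / 2)) ^ n)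
    ((X ^ (-s / 2)) ^ n)
  have hW1 := U_add_U_mul 1 (by norm_num) ℓ (-B) X (X ^ (A : ℂ))
    (X ^ (A : ℂ) * (X ^ (-s / 2)) ^ n) ((X ^ (-s / 2)) ^ n)
  have hterm : ∀ (ω : ℕ) (C : ℝ) (J : Finset ℕ),
      X ^ ((C * bracket ℓ J : ℝ) : ℂ) *
        scriptU ℓ J X (X ^ (A : ℂ)) (X ^ (A : ℂ) * (X ^ (-s / 2)) ^ n) *
        (X ^ (A : ℂ) * (X ^ (-s / 2)) ^ n) ^ J.card * ((X ^ (-s / 2)) ^ n) ^ ((J.card + ω) % 2) *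
        ((X ^ (-s / 2)) ^ m) ^ ω =
      ∑ I ∈ (J ∩ Finset.Icc 1 (ℓ - 1)).powerset ×ˢ (Finset.Icc 1 (ℓ - 1) \ J).powerset,
        w ℓ (I.1 ∪ I.2) X⁻¹ * X ^ ((xExp ℓ A C J I.2 : ℂ) -
          ((n * tExp ω J I.2 + ω * m : ℕ) : ℂ) / 2 * s) := by
    intro ω C J
    rw [scriptU, ← Finset.sum_product', Finset.mul_sum, Finset.mul_sum, Finset.sum_mul,
      Finset.sum_mul, Finset.sum_mul]
    refine Finset.sum_congr rfl fun I _ => ?_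
    have h := monomial_eq hX s A ((C * bracket ℓ J : ℝ) : ℂ) (bExp ℓ J) (aExp ℓ J) (bExp ℓ I.2)
      (aExp ℓ I.2) J.card I.2.card ((J.card + ω) % 2) n ω m
    have h1 := aExp_add_bExp ℓ A J
    have h2 := aExp_add_bExp ℓ A I.2
    have he : ((C * bracket ℓ J : ℝ) : ℂ) + ((aExp ℓ J : ℂ) + A * bExp ℓ J + A * J.card) +
        2 * ((aExp ℓ I.2 : ℂ) + A * bExp ℓ I.2 + A * I.2.card) -
        (n * (J.card + 2 * I.2.card + ((J.card + ω) % 2 : ℕ)) + ω * m) / 2 * s =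
        (xExp ℓ A C J I.2 : ℂ) - ((n * tExp ω J I.2 + ω * m : ℕ) : ℂ) / 2 * s := by
      rw [xExp, ← h1, ← h2, tExp]
      push_cast
      ring
    rw [he] at h
    linear_combination (w ℓ (I.1 ∪ I.2) X⁻¹) * h
  rw [Wtotal, W0, W1, hn, hm, Complex.ofReal_natCast, Complex.cpow_natCast, Complex.ofReal_natCast,
    Complex.cpow_natCast, add_comm (_ * _) (U 1 ℓ (-B) _ _ _), hW0, hW1, indices,
    Finset.sum_sigma, Finset.sum_range_succ, Finset.sum_range_one, Finset.sum_sigma,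
    Finset.sum_sigma, Finset.sum_mul]
  congr 1
  · refine Finset.sum_congr rfl fun J _ => ?_
    have := hterm 0 B J
    rw [pow_zero, mul_one] at this
    simpa using this
  · refine Finset.sum_congr rfl fun J _ => ?_
    have := hterm 1 (-B) J
    rw [pow_one] at this
    simpa using this

/-- Evenness turns powers of `Y = p^(-s/2)` into integral powers of `p^(-s)`, as the Dirichlet
series requires. In the second case `n` is odd and `m = 1`, and `tExp + ω` is even by the definition
of the parity term. -/
lemma exists_nat_exponents {ℓ : ℕ} {A B : ℝ}
    (hAB : (A = 0 ∧ B = -1) ∨ (A = -1 / 2 ∧ B = -1 / 2)) :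
    ∃ n m : ℕ, 0 < n ∧ 0 < m ∧ dim ℓ A = n ∧ -2 * B = m ∧
      ∀ (ω : ℕ) (J I₁ : Finset ℕ), Even (n * tExp ω J I₁ + ω * m) := by
  rcases hAB with ⟨rfl, rfl⟩ | ⟨rfl, rfl⟩
  · refine ⟨2 * (ℓ + 1), 2, by omega, by omega, by rw [dim]; push_cast; ring, by norm_num,
      fun ω J I₁ => ?_⟩
    exact ⟨(ℓ + 1) * tExp ω J I₁ + ω, by ring⟩
  · refine ⟨2 * ℓ + 1, 1, by omega, by omega, by rw [dim]; push_cast; ring, by norm_num,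
      fun ω J I₁ => ?_⟩
    have h : (2 * ℓ + 1) * tExp ω J I₁ + ω * 1 = 2 * (ℓ * tExp ω J I₁) + (tExp ω J I₁ + ω) := by
      ring
    rw [h, Nat.even_add]
    have h2 : Even (tExp ω J I₁ + ω) := by rw [Nat.even_iff, tExp]; omega
    simp [h2]

lemma eq_empty_of_subset_inter {ℓ : ℕ} {J I : Finset ℕ} (h : I ⊆ J ∩ Finset.Icc 1 (ℓ - 1))
    (hJ : J ⊆ {0}) : I = ∅ := by
  refine Finset.eq_empty_of_forall_notMem fun i hi => ?_
  have h1 := Finset.mem_inter.1 (h hi)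
  have h2 := Finset.mem_singleton.1 (hJ h1.1)
  have h3 := (Finset.mem_Icc.1 h1.2).1
  omega

/-- The Euler factors of the total ASH polynomial have a dominant term. -/
theorem exists_eulerData {ℓ : ℕ} (hℓ : 0 < ℓ) {A B : ℝ}
    (hAB : (A = 0 ∧ B = -1) ∨ (A = -1 / 2 ∧ B = -1 / 2)) :
    ∃ D : EulerData, D.b = bo ℓ A B ∧
      ∀ p : ℕ, p.Prime → ∀ s, eulerFactor ℓ A B p s = D.factor p s := by
  obtain ⟨n, m, hn0, hm0, hn, hm, heven⟩ := exists_nat_exponents (ℓ := ℓ) hAB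
  choose C hC using fun i : Index => realW_le ℓ (i.2.2.1 ∪ i.2.2.2)
  set i₀ : Index := ⟨0, ∅, ∅, ∅⟩ with hi₀
  set i₁ : Index := ⟨1, {0}, ∅, ∅⟩ with hi₁
  set S := ((indices ℓ).erase i₀).erase i₁ with hS
  have hmem₀ : i₀ ∈ indices ℓ := by simp [mem_indices, hi₀]
  have hmem₁ : i₁ ∈ (indices ℓ).erase i₀ := by
    refine Finset.mem_erase.2 ⟨by simp [hi₀, hi₁], ?_⟩
    simp [mem_indices, hi₁, hℓ]
  have hinv : ∀ p : ℕ, p.Prime → 0 < (p : ℝ)⁻¹ ∧ (p : ℝ)⁻¹ ≤ 1 / 2 := fun p hp => by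
    have : (2 : ℝ) ≤ p := by exact_mod_cast hp.two_le
    refine ⟨by positivity, ?_⟩
    rw [inv_le_comm₀ (by linarith) (by norm_num)]
    linarith
  have hK : ∀ i ∈ indices ℓ, i.2.2.1 ∪ i.2.2.2 ⊆ Finset.Icc 1 (ℓ - 1) := fun i hi => by
    obtain ⟨-, -, h1, h2⟩ := mem_indices.1 hi
    exact Finset.union_subset (h1.trans Finset.inter_subset_right) (h2.trans Finset.sdiff_subset)
  -- When `J ⊆ {0}`, the set `I₀` is forced to be empty, so `ω`, `J` and `I₁` determine the index.
  have hne₀ : ∀ i ∈ indices ℓ, i ≠ i₀ → ¬ (i.1 = 0 ∧ i.2.1 = ∅ ∧ i.2.2.2 = ∅) := by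
    rintro ⟨ω, J, I₀, I₁⟩ hi hne ⟨h1, h2, h3⟩
    obtain ⟨-, -, h4, -⟩ := mem_indices.1 hi
    simp only at h1 h2 h3 h4
    have h5 := eq_empty_of_subset_inter h4 (by simp [h2])
    subst h1 h2 h3 h5
    exact hne rfl
  have hne₁ : ∀ i ∈ indices ℓ, i ≠ i₁ → ¬ (i.1 = 1 ∧ i.2.1 = {0} ∧ i.2.2.2 = ∅) := by
    rintro ⟨ω, J, I₀, I₁⟩ hi hne ⟨h1, h2, h3⟩
    obtain ⟨-, -, h4, -⟩ := mem_indices.1 hi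
    simp only at h1 h2 h3 h4
    have h5 := eq_empty_of_subset_inter h4 h2.subset
    subst h1 h2 h3 h5
    exact hne rfl
  have hSi : ∀ i ∈ S, i ∈ indices ℓ ∧ i ≠ i₀ ∧ i ≠ i₁ := fun i hi => by
    simp only [hS, Finset.mem_erase] at hi
    tauto
  have hk : ∀ i : Index, (((n * tExp i.1 i.2.1 i.2.2.2 + i.1 * m) / 2 : ℕ) : ℝ)
      = (dim ℓ A * tExp i.1 i.2.1 i.2.2.2 + i.1 * (-2 * B)) / 2 := fun i => by
    rw [Nat.cast_div (heven _ _ _).two_dvd (by norm_num), hn, hm]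
    push_cast
    ring
  have hnm : Even (n + m) := by simpa [tExp] using heven 1 {0} ∅
  have hd : (((n + m) / 2 : ℕ) : ℝ) = (dim ℓ A - 2 * B) / 2 := by
    rw [Nat.cast_div hnm.two_dvd (by norm_num), hn, sub_eq_add_neg, ← neg_mul, hm]
    push_cast
    ring
  have hdpos : 0 < (n + m) / 2 := by omega
  refine ⟨{ ι := Index
            S := S
            c := fun i p => realW ℓ (i.2.2.1 ∪ i.2.2.2) (p : ℝ)⁻¹
            M := ∑ i ∈ S, |C i|
            α := fun i => xExp ℓ A (if i.1 = 0 then B else -B) i.2.1 i.2.2.2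
            k := fun i => (n * tExp i.1 i.2.1 i.2.2.2 + i.1 * m) / 2
            e := ℓ * (dim ℓ A - 2 * B - ℓ - 1) / 2
            d := (n + m) / 2
            b := bo ℓ A B
            c_nonneg := ?_
            c_le := ?_
            d_pos := hdpos
            k_pos := ?_
            d_mul_b := ?_
            dominated := ?_ }, rfl, ?_⟩
  · intro i hi p hp
    obtain ⟨h1, h2⟩ := hinv p hp
    exact realW_nonneg h1 (by linarith) hℓ (hK i (hSi i hi).1)
  · intro i hi p hp
    obtain ⟨h1, h2⟩ := hinv p hp
    exact ((hC i _ h1 h2).trans (le_abs_self _)).trans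
      (Finset.single_le_sum (f := fun i => |C i|) (fun _ _ => abs_nonneg _) hi)
  · intro i hi
    obtain ⟨h1, h2, -⟩ := hSi i hi
    have h3 := hne₀ i h1 h2
    have h4 : 0 < n * tExp i.1 i.2.1 i.2.2.2 + i.1 * m := by
      by_contra h
      have h5 : n * tExp i.1 i.2.1 i.2.2.2 = 0 ∧ i.1 * m = 0 := by omega
      have h6 : tExp i.1 i.2.1 i.2.2.2 = 0 := by simpa [hn0.ne'] using h5.1
      rw [tExp] at h6
      exact h3 ⟨by simpa [hm0.ne'] using h5.2, Finset.card_eq_zero.1 (by omega),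
        Finset.card_eq_zero.1 (by omega)⟩
    have h5 := (heven i.1 i.2.1 i.2.2.2).two_dvd
    omega
  · have h : dim ℓ A - 2 * B ≠ 0 := by
      intro h
      rw [h, zero_div] at hd
      exact hdpos.ne' (by exact_mod_cast hd)
    rw [hd, bo]
    field_simp
  · intro i hi
    obtain ⟨h1, h2, h3⟩ := hSi i hi
    obtain ⟨h4, h5, -⟩ := mem_indices.1 h1
    rw [hk]
    exact xExp_add_one_lt hℓ hAB (fun j hj => Finset.mem_range.1 (h5 hj)) h4 (hne₀ i h1 h2)
      (hne₁ i h1 h3)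
  · intro p hp s
    have hX : (p : ℂ) ≠ 0 := by exact_mod_cast hp.ne_zero
    obtain ⟨hp0, hp1⟩ := hinv p hp
    have hw : ∀ i ∈ indices ℓ, w ℓ (i.2.2.1 ∪ i.2.2.2) (p : ℂ)⁻¹
        = (realW ℓ (i.2.2.1 ∪ i.2.2.2) (p : ℝ)⁻¹ : ℂ) := fun i hi => by
      rw [← w_ofReal]
      · push_cast; rfl
      · intro j hj
        have := Finset.mem_Icc.1 (hK i hi hj)
        omega
    have hw0 : w ℓ ∅ (p : ℂ)⁻¹ = 1 := by
      have := hw i₀ hmem₀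
      simp only [hi₀, Finset.union_empty] at this
      rw [this, realW_empty ℓ hp0 (by linarith), Complex.ofReal_one]
    have hkc : ∀ i : Index, (((n * tExp i.1 i.2.1 i.2.2.2 + i.1 * m) / 2 : ℕ) : ℂ)
        = ((n * tExp i.1 i.2.1 i.2.2.2 + i.1 * m : ℕ) : ℂ) / 2 := fun i => by
      rw [Nat.cast_div (heven _ _ _).two_dvd (by norm_num), Nat.cast_ofNat]
    have hdc : (((n + m) / 2 : ℕ) : ℂ) = ((n + m : ℕ) : ℂ) / 2 := by
      rw [Nat.cast_div hnm.two_dvd (by norm_num), Nat.cast_ofNat]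
    rw [eulerFactor, Wtotal_eq hn hm hX, ← Finset.add_sum_erase _ _ hmem₀,
      ← Finset.add_sum_erase _ _ hmem₁, ← hS, EulerData.factor, EulerData.main, EulerData.tail,
      ← add_assoc]
    congr 1
    · congr 1
      · simp [hi₀, hw0, xExp, tExp, bracket]
      · have h1 : tExp 1 {0} ∅ = 1 := by simp [tExp]
        have h2 : xExp ℓ A (-B) {0} ∅ = ℓ * (dim ℓ A - 2 * B - ℓ - 1) / 2 := by
          have h3 : bracket ℓ {0} = ℓ := by simp [bracket, Finset.filter_singleton]
          rw [xExp, h3, Finset.sum_singleton, Finset.sum_empty, expo, dim]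
          push_cast
          ring
        simp only [hi₁, Finset.union_empty, hw0, one_ne_zero, if_false, h1, h2, one_mul, mul_one]
        rw [hdc]
    · refine Finset.sum_congr rfl fun i hi => ?_
      simp only
      rw [hw i (hSi i hi).1, hkc]

lemma eulerAbscissa_congr {f g : ℕ → ℂ → ℂ} (h : ∀ p : ℕ, p.Prime → ∀ s, f p s = g p s) :
    eulerAbscissa f = eulerAbscissa g := by
  have h1 : ∀ s, PrimeProdConverges (fun p => f p s) ↔ PrimeProdConverges fun p => g p s := by
    intro s
    have h2 : ∀ M N : ℕ, ∏ p ∈ (Finset.Ico M N).filter Nat.Prime, f p s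
        = ∏ p ∈ (Finset.Ico M N).filter Nat.Prime, g p s := fun M N =>
      Finset.prod_congr rfl fun p hp => h p (Finset.mem_filter.1 hp).2 s
    simp only [PrimeProdConverges, h2]
  simp only [eulerAbscissa, h1]

end TotalASH

theorem mainTheorem11 (ℓ : ℕ) (hℓ : 0 < ℓ) (A B : ℝ)
    (hAB : (A = 0 ∧ B = -1) ∨ (A = -1 / 2 ∧ B = -1 / 2)) :
    -- absolute and locally uniform convergence on `Re s > b_o`
    ((∀ s : ℂ, TotalASH.bo ℓ A B < s.re →
        Summable fun p : Nat.Primes => ‖TotalASH.eulerFactor ℓ A B p s - 1‖) ∧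
      SummableLocallyUniformlyOn
        (fun (p : Nat.Primes) (s : ℂ) => ‖TotalASH.eulerFactor ℓ A B p s - 1‖)
        {s : ℂ | TotalASH.bo ℓ A B < s.re} ∧
      MultipliableLocallyUniformlyOn
        (fun (p : Nat.Primes) (s : ℂ) => TotalASH.eulerFactor ℓ A B p s)
        {s : ℂ | TotalASH.bo ℓ A B < s.re}) ∧
    -- meromorphic continuation to a half-plane containing `b_o`, with a simple pole there
    (∃ c : ℝ, c < TotalASH.bo ℓ A B ∧ ∃ F : ℂ → ℂ,
      MeromorphicOn F {s : ℂ | c < s.re} ∧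
      (∀ s : ℂ, TotalASH.bo ℓ A B < s.re →
        F s = ∏' p : Nat.Primes, TotalASH.eulerFactor ℓ A B p s) ∧
      meromorphicOrderAt F (TotalASH.bo ℓ A B : ℂ) = -1) ∧
    -- `b_o` is the abscissa of convergence, of the Euler product as well as of the Dirichlet
    -- series with nonnegative coefficients into which it expands
    (TotalASH.eulerAbscissa (TotalASH.eulerFactor ℓ A B) = (TotalASH.bo ℓ A B : EReal) ∧
      ∃ a : ℕ → ℝ, (∀ m, 0 ≤ a m) ∧
        (∀ s : ℂ, TotalASH.bo ℓ A B < s.re →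
          LSeriesHasSum (fun m => (a m : ℂ)) s
            (∏' p : Nat.Primes, TotalASH.eulerFactor ℓ A B p s)) ∧
        TotalASH.dirichletAbscissa (fun m => (a m : ℂ)) = (TotalASH.bo ℓ A B : EReal) ∧
        LSeries.abscissaOfAbsConv (fun m => (a m : ℂ)) = (TotalASH.bo ℓ A B : EReal)) := by
  obtain ⟨D, hb, hD⟩ := TotalASH.exists_eulerData hℓ hAB
  have hD' : ∀ (p : Nat.Primes) (s : ℂ), TotalASH.eulerFactor ℓ A B p s = D.factor p s :=
    fun p s => hD p p.2 s
  simp only [hD', ← hb, TotalASH.eulerAbscissa_congr hD]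
  exact ⟨⟨fun _ hs => D.summable_norm_factor_sub_one hs, D.summableLocallyUniformlyOn,
    D.multipliableLocallyUniformlyOn⟩, D.exists_meromorphic_continuation, D.eulerAbscissa_eq,
    D.coeff, D.coeff_nonneg, fun _ hs => D.lseriesHasSum hs, D.dirichletAbscissa_eq,
    D.abscissaOfAbsConv_eq⟩
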